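/- **Notation.** Let $k\ge 1$ and $\mathbf n=(n_1,\dots,n_k)$ with $n_i\ge 1$. Let $\mathbb F^+_{n_i}$ be the free monoid on $g^i_1,\dots,g^i_{n_i}$ with unit $g^i_0$, and $|\alpha|$ the length of a word. For words $\boldsymbol\omega,\boldsymbol\gamma\in \mathbb F^+_{\mathbf n}:=\mathbb F^+_{n_1}\times\cdots\times\mathbb F^+_{n_k}$ write $\boldsymbol\omega\le_r\boldsymbol\gamma$ if for each $i$ there is $\sigma_i\in\mathbb F_{n_i}^+$ with $\gamma_i=\sigma_i\omega_i$. A set $\Lambda\subset \mathbb F^+_{\mathbf n}$ is *right minimal* if $\boldsymbol\omega\le_r\boldsymbol\gamma$ with $\boldsymbol\omega,\boldsymbol\gamma\in\Lambda$ implies $\boldsymbol\omega=\boldsymbol\gamma$. For a Hilbert space $\mathcal E$, the *regular polyball* $\mathbf B_{\mathbf n}(\mathcal E)$ is the set of tuples $\mathbf X=(X_{i,j})_{1\le i\le k,\,1\le j\le n_i}$ in $B(\mathcal E)$ such that $X_{s,a}X_{t,b}=X_{t,b}X_{s,a}$ whenever $s\ne t$, $\big\|\sum_j X_{i,j}X_{i,j}^*\big\|<1$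 for every $i$, and $(\mathrm{id}-\Phi_{X_1})\circ\cdots\circ(\mathrm{id}-\Phi_{X_k})(I)$ is positive and invertible, where $\Phi_{X_i}(Y)=\sum_j X_{i,j}YX_{i,j}^*$. Put $\mathbf X_{\boldsymbol\alpha}=X_{1,\alpha_1}\cdots X_{k,\alpha_k}$, where $X_{i,\alpha_i}=X_{i,j_1}\cdots X_{i,j_p}$ if $\alpha_i=g^i_{j_1}\cdots g^i_{j_p}$, and $X_{i,g_0^i}=I$. The universal model $\mathbf S=(\mathbf S_{i,j})$ acts on $F^2(H_{n_1})\otimes\cdots\otimes F^2(H_{n_k})$, the tensor product of full Fock spaces, with orthonormal basis $(e_{\boldsymbol\alpha})_{\boldsymbol\alpha\in\mathbb F^+_{\mathbf n}}$; the operator $\mathbf S_{i,j}$ maps $e_{\boldsymbol\alpha}$ to the basis vector of the word obtained from $\boldsymbol\alpha$ by replacing $\alpha_i$ with $g^i_j\alpha_i$. The set $\Lambda$ is *orthogonal* if $\mathbf S_{\boldsymbol\beta}^*\mathbf S_{\boldsymbol\alpha}=0$ for all distinct $\boldsymbol\alpha,\boldsymbol\beta\in\Lambda$. Let $\mathcal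 K$ be a complex Hilbert space and $A_{(\boldsymbol\alpha)}\in B(\mathcal K)$, $\boldsymbol\alpha\in\mathbb F^+_{\mathbf n}$. The series $F(\mathbf X)=\sum_{\boldsymbol\alpha}A_{(\boldsymbol\alpha)}\otimes\mathbf X_{\boldsymbol\alpha}$ is *free holomorphic* if $\sum_{\mathbf p\in\mathbb Z_+^k}\Big(\sum_{|\alpha_i|=p_i\ (1\le i\le k)}A_{(\boldsymbol\alpha)}\otimes\mathbf X_{\boldsymbol\alpha}\Big)$ converges in operator norm for every Hilbert space $\mathcal E$ and every $\mathbf X\in\mathbf B_{\mathbf n}(\mathcal E)$; its sum is $F(\mathbf X)$. Write $A_0:=A_{(g_0^1,\dots,g_0^k)}$. **Theorem (Landau-type inequality).** Let $\mathcal H$ be an infinite-dimensional complex Hilbert space. Let $F$ be free holomorphic with coefficients $A_{(\boldsymbol\alpha)}\in B(\mathcal K)$ such that $F(0)\ge 0$ and $\Re F(\mathbf X)\le I$ for every $\mathbf X\in\mathbf B_{\mathbf n}(\mathcal H)$, and let $\Lambda\subset\mathbb F^+_{\mathbf n}$ be a right minimal set that does not contain $(g_0^1,\dots,g_0^k)$.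 Then: 1. The operator matrix $$P_\Lambda=\begin{pmatrix}2(I-A_0)&[A_{(\boldsymbol\alpha)}^*:\boldsymbol\alpha\in\Lambda]\\ [A_{(\boldsymbol\alpha)}]_{\boldsymbol\alpha\in\Lambda}&\operatorname{diag}_{\Lambda}\big(2(I-A_0)\big)\end{pmatrix}$$ defines a bounded positive operator on $\mathcal K\oplus\bigoplus_{\boldsymbol\alpha\in\Lambda}\mathcal K$. 2. The series $\sum_{\boldsymbol\alpha\in\Lambda}A_{(\boldsymbol\alpha)}^*A_{(\boldsymbol\alpha)}$ converges in the strong operator topology and $$\sum_{\boldsymbol\alpha\in\Lambda}A_{(\boldsymbol\alpha)}^*A_{(\boldsymbol\alpha)}\le 4\|I-A_0\|\,(I-A_0).$$ 3. If, in addition, $\Lambda$ is orthogonal, then $\sum_{\boldsymbol\alpha\in\Lambda}A_{(\boldsymbol\alpha)}\otimes\mathbf S_{\boldsymbol\alpha}$ converges in the strong operator topology, $\sum_{\boldsymbol\alpha\in\Lambda}A_{(\boldsymbol\alpha)}\otimes\mathbf X_{\boldsymbol\alpha}$ converges unconditionally in operator norm for every Hilbert space $\mathcal E$ and every $\mathbf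 X\in\mathbf B_{\mathbf n}(\mathcal E)$, and $$\sup_{\mathbf X\in\mathbf B_{\mathbf n}}\Big\|\sum_{\boldsymbol\alpha\in\Lambda}A_{(\boldsymbol\alpha)}\otimes\mathbf X_{\boldsymbol\alpha}\Big\|=\Big\|\sum_{\boldsymbol\alpha\in\Lambda}A_{(\boldsymbol\alpha)}\otimes\mathbf S_{\boldsymbol\alpha}\Big\|\le 2\|I-A_0\|,$$ where the supremum may be taken over $\mathbf B_{\mathbf n}(\mathcal H)$ alone or over $\mathbf B_{\mathbf n}(\mathcal E)$ for all Hilbert spaces $\mathcal E$. -/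

import Mathlib

open scoped TensorProduct

universe u v w

namespace Polyball

noncomputable section

/-! ### Words -/

/-- The product `𝔽⁺_{n₁} × ⋯ × 𝔽⁺_{n_k}` of free monoids. It is a monoid under the componentwise
product, and its unit `1` is the neutral element `(g₀¹, …, g₀ᵏ)`. -/
abbrev Word {k : ℕ} (n : Fin k → ℕ) : Type := (i : Fin k) → FreeMonoid (Fin (n i))

variable {k : ℕ} {n : Fin k → ℕ}

/-- `ω ≤ᵣ γ`: every component of `ω` is a right divisor of the same component of `γ`. -/
def RightLE (ω γ : Word n) : Prop :=
  ∀ i, ∃ σ : FreeMonoid (Fin (n i)), γ i = σ * ω i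

/-- `Λ` is right minimal: distinct elements are incomparable for `≤ᵣ`. -/
def IsRightMinimal (Λ : Set (Word n)) : Prop :=
  ∀ ω ∈ Λ, ∀ γ ∈ Λ, RightLE ω γ → ω = γ

/-- The words of length `l` over an alphabet with `m` letters. -/
def wordsOfLength (m l : ℕ) : Finset (FreeMonoid (Fin m)) :=
  (Finset.univ : Finset (Fin l → Fin m)).map
    ⟨fun a => FreeMonoid.ofList (List.ofFn a), fun _ _ h => List.ofFn_injective h⟩

theorem mem_wordsOfLength {m l : ℕ} (α : FreeMonoid (Fin m)) :
    α ∈ wordsOfLength m l ↔ α.length = l := by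
  simp only [wordsOfLength, Finset.mem_map, Finset.mem_univ, true_and]
  constructor
  · rintro ⟨a, rfl⟩
    exact List.length_ofFn
  · rintro rfl
    exact ⟨fun i => α.toList.get i, List.ofFn_get α.toList⟩

/-- The finite set `Λ_p = {α : |α_i| = p_i for all i}` of words of multidegree `p`. -/
def multiDegree (n : Fin k → ℕ) (p : Fin k → ℕ) : Finset (Word n) :=
  Fintype.piFinset fun i => wordsOfLength (n i) (p i)

theorem mem_multiDegree (p : Fin k → ℕ) (α : Word n) :
    α ∈ multiDegree n p ↔ ∀ i, (α i).length = p i := by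
  simp [multiDegree, mem_wordsOfLength]

/-! ### Tuples of operators and the regular polyball -/

/-- Tuples `X = (X₁, …, X_k)`, `X_i = (X_{i,1}, …, X_{i,n_i})`, of bounded operators on `H`. -/
abbrev OpTuple (n : Fin k → ℕ) (H : Type u) [NormedAddCommGroup H] [InnerProductSpace ℂ H] :
    Type u :=
  (i : Fin k) → Fin (n i) → (H →L[ℂ] H)

section Operators

variable {H : Type u} [NormedAddCommGroup H] [InnerProductSpace ℂ H]

/-- `X_α = X_{1,α₁} ⋯ X_{k,α_k}`, where `X_{i,α_i}` is the product of the `X_{i,j}` along the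
letters `j` of `α_i`. -/
def monomial (X : OpTuple n H) (α : Word n) : H →L[ℂ] H :=
  (List.ofFn fun i => FreeMonoid.lift (X i) (α i)).prod

variable [CompleteSpace H]

/-- The map `Φ_{X_i}(Y) = ∑_j X_{i,j} Y X_{i,j}^*`. -/
def rowMap {m : ℕ} (Xi : Fin m → (H →L[ℂ] H)) : Module.End ℂ (H →L[ℂ] H) :=
  ∑ j, LinearMap.mulLeft ℂ (Xi j) ∘ₗ LinearMap.mulRight ℂ (ContinuousLinearMap.adjoint (Xi j))

/-- The defect mapping `Δ_X = (id - Φ_{X₁}) ∘ ⋯ ∘ (id - Φ_{X_k})`. -/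
def defectMap (X : OpTuple n H) : Module.End ℂ (H →L[ℂ] H) :=
  (List.ofFn fun i => 1 - rowMap (X i)).prod

/-- The regular polyball `B_n(H)`: the entries of different rows commute, each row is a strict
row contraction, and `Δ_X(I)` is positive and invertible. -/
def regularPolyball (n : Fin k → ℕ) (H : Type u) [NormedAddCommGroup H] [InnerProductSpace ℂ H]
    [CompleteSpace H] : Set (OpTuple n H) :=
  {X | (∀ s t, s ≠ t → ∀ a b, Commute (X s a) (X t b)) ∧
    (∀ i, ‖∑ j, X i j * ContinuousLinearMap.adjoint (X i j)‖ < 1) ∧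
    IsStrictlyPositive (defectMap X 1)}

end Operators

/-! ### The universal model -/

/-- The Hilbert space `F²(H_{n₁}) ⊗ ⋯ ⊗ F²(H_{n_k})`, realised as `ℓ²` of the set of words through
its orthonormal basis `e_α = e_{α₁} ⊗ ⋯ ⊗ e_{α_k}`. -/
abbrev Fock (n : Fin k → ℕ) : Type := lp (fun _ : Word n => ℂ) 2

open Classical in
/-- The basis vector `e_α`. -/
def fockBasis (α : Word n) : Fock n := lp.single 2 α 1

theorem orthonormal_fockBasis : Orthonormal ℂ (fockBasis (n := n)) := by
  classical
  rw [orthonormal_iff_ite]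
  intro α β
  simp only [fockBasis, lp.inner_single_left, lp.single_apply, Pi.single_apply]
  split_ifs <;> simp_all

/-- The word obtained by writing the letter `g_jⁱ` in front of the `i`-th component of `α`. -/
def prependLetter (i : Fin k) (j : Fin (n i)) (α : Word n) : Word n :=
  Function.update α i (FreeMonoid.of j * α i)

theorem prependLetter_injective (i : Fin k) (j : Fin (n i)) :
    Function.Injective (prependLetter (n := n) i j) := by
  intro α β h
  funext l
  have hl := congrFun h l
  by_cases hli : l = i
  · subst hli
    simpa [prependLetter] using hl
  · simpa [prependLetter, hli] using hl

theorem orthogonalFamily_prepend (i : Fin k) (j : Fin (n i)) :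
    OrthogonalFamily ℂ (fun _ : Word n => ℂ) fun α =>
      LinearIsometry.toSpanSingleton ℂ (Fock n)
        (orthonormal_fockBasis.1 (prependLetter i j α)) :=
  (orthonormal_fockBasis.comp _ (prependLetter_injective i j)).orthogonalFamily

/-- The universal model `S = (S_{i,j})`: `S_{i,j}` is the isometry that sends `e_α` to the basis
vector of the word in which `g_jⁱ` is written in front of `α_i`, that is, the left creation operator
on the `i`-th Fock space tensored with identities. -/
def universalModel (n : Fin k → ℕ) : OpTuple n (Fock n) := fun i j =>
  (orthogonalFamily_prepend i j).linearIsometry.toContinuousLinearMap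

theorem universalModel_fockBasis (i : Fin k) (j : Fin (n i)) (α : Word n) :
    universalModel n i j (fockBasis α) = fockBasis (prependLetter i j α) := by
  classical
  have h := (orthogonalFamily_prepend i j).linearIsometry_apply_single (i := α) (1 : ℂ)
  simp only [LinearIsometry.toSpanSingleton_apply, one_smul] at h
  rw [← h]

  simp only [universalModel, LinearIsometry.coe_toContinuousLinearMap, fockBasis]
/-- `Λ` is orthogonal: the isometries `S_α`, `α ∈ Λ`, have pairwise orthogonal ranges. -/
def IsOrthogonalSet (Λ : Set (Word n)) : Prop :=
  ∀ α ∈ Λ, ∀ β ∈ Λ, α ≠ β →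
    ContinuousLinearMap.adjoint (monomial (universalModel n) β) * monomial (universalModel n) α = 0

/-! ### Hilbert tensor products and operator-valued series -/

/-- The Hilbert space tensor product. -/
abbrev HilbertTensor (K : Type v) (H : Type u) [NormedAddCommGroup K] [InnerProductSpace ℂ K]
    [NormedAddCommGroup H] [InnerProductSpace ℂ H] : Type (max u v) :=
  UniformSpace.Completion (K ⊗[ℂ] H)

/-- The bounded operator `A ⊗ X` on the Hilbert space tensor product. -/
def opTensor {K : Type v} {H : Type u} [NormedAddCommGroup K] [InnerProductSpace ℂ K]
    [NormedAddCommGroup H] [InnerProductSpace ℂ H] (A : K →L[ℂ] K) (X : H →L[ℂ] H) :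
    HilbertTensor K H →L[ℂ] HilbertTensor K H :=
  (TensorProduct.mapL A X).completion

/-- `∑ f i = T` in the strong operator topology. -/
def HasStrongSum {ι : Type*} {E : Type u} {E' : Type v} [NormedAddCommGroup E]
    [InnerProductSpace ℂ E] [NormedAddCommGroup E'] [InnerProductSpace ℂ E']
    (f : ι → (E →L[ℂ] E')) (T : E →L[ℂ] E') : Prop :=
  ∀ x, HasSum (fun i => f i x) (T x)

section Series

variable {K : Type v} [NormedAddCommGroup K] [InnerProductSpace ℂ K]

/-- The part `∑_{α ∈ Λ_p} A_α ⊗ X_α` of multidegree `p` of the series at `X`. -/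
def seriesTerm {H : Type u} [NormedAddCommGroup H] [InnerProductSpace ℂ H]
    (A : Word n → (K →L[ℂ] K)) (X : OpTuple n H) (p : Fin k → ℕ) :
    HilbertTensor K H →L[ℂ] HilbertTensor K H :=
  ∑ α ∈ multiDegree n p, opTensor (A α) (monomial X α)

/-- The formal power series `∑_α A_α ⊗ Z_α` is a free holomorphic function on the abstract regular
polyball: on every Hilbert space, its multi-homogeneous expansion converges in operator norm at
every point of the polyball. -/
def IsFreeHolomorphic (A : Word n → (K →L[ℂ] K)) : Prop :=
  ∀ (H : Type u) [NormedAddCommGroup H] [InnerProductSpace ℂ H] [CompleteSpace H],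
    ∀ X ∈ regularPolyball n H, Summable (seriesTerm A X)

/-- The value `F(X)`, the (operator norm) sum of the multi-homogeneous expansion at `X`. -/
def freeEval {H : Type u} [NormedAddCommGroup H] [InnerProductSpace ℂ H]
    (A : Word n → (K →L[ℂ] K)) (X : OpTuple n H) :
    HilbertTensor K H →L[ℂ] HilbertTensor K H :=
  ∑' p, seriesTerm A X p

/-! ### Operator matrices -/

open Classical in
/-- The bounded operator `T` on the Hilbert direct sum `⨁_{i ∈ ι} K` has the operator matrix
`(M i j)`. -/
def HasOperatorMatrix {ι : Type*} (T : lp (fun _ : ι => K) 2 →L[ℂ] lp (fun _ : ι => K) 2)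
    (M : ι → ι → (K →L[ℂ] K)) : Prop :=
  ∀ (i j : ι) (x : K), T (lp.single 2 j x) i = M i j x

open Classical in
/-- The entries of the operator matrix `P_Λ`, indexed by `Λ` with one extra point `none` (the first
row and column): `2(I - A₀)` on the diagonal, the `A_α` down the first column, the `A_α^*` along the
first row, and zeros elsewhere. -/
def landauMatrix [CompleteSpace K] (A : Word n → (K →L[ℂ] K)) (Λ : Set (Word n)) :
    Option Λ → Option Λ → (K →L[ℂ] K)
  | none, none => (2 : ℂ) • (1 - A 1)
  | none, some α => ContinuousLinearMap.adjoint (A α)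
  | some α, none => A α
  | some α, some β => if α = β then (2 : ℂ) • (1 - A 1) else 0

end Series

end

end Polyball

/-!
Let `D = 1 - A₀`. The compressions of `2 Re (1 - F)` at suitable points of the polyball to the
span of the vectors `x ⊗ e_ω`, `ω ∈ {1} ∪ Λ`, are, up to signs and powers of `r`, the Landau matrix
of the statement: this is what positivity of `1 - Re F` is used for.

*The test points.* An infinite-dimensional `H` contains an isometric copy of the Fock space; the
tuple `r S`, `0 ≤ r < 1`, transported to it and extended by zero, lies in the polyball of `H`
(`modelPoint_mem`), because its rows doubly commute, so that its defect operator is a product of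
commuting strictly positive operators. At such a point the entry of `F` from `x ⊗ e_ω` to
`y ⊗ e_γ` is `r^{|α|} ⟨y, A_α x⟩` if `γ = α ω`, and zero if `ω ≤ᵣ γ` fails
(`inner_freeEval_of_eq_mul`, `inner_freeEval_of_not_rightLE`). Right minimality of `Λ` therefore
leaves only the diagonal and the first column, and `r → 1` gives positivity of the finite sections
of the Landau matrix (`landau_finite`). The full matrix is bounded because its column is
(`exists_landauMatrix_nonneg`).

*The inequality.* Testing the finite sections on `y_α = t A_α x` with the best real `t` yields
`∑ ‖A_α x‖² ≤ 4 ‖D‖ ⟨x, D x⟩` (`sum_norm_sq_coeff_le`), which is the second assertion. In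
particular the column `[A_α]` has norm at most `2 ‖D‖`.

*Orthogonal sets.* Here the `A_α ⊗ S_α` have orthogonal ranges, so the norm of `∑ A_α ⊗ S_α` is
that of the column `[A_α]`. At a point `X` of a polyball, `∑ A_α ⊗ X_α` is the product of the row
`[1 ⊗ X_α]` and the column `[A_α ⊗ 1]` (`norm_sum_opTensor_le`). The row is a contraction: in the
reproducing identity `∑_γ X_γ Δ_X(I) X_γ^* = I` (`hasSum_monomial_defect`) orthogonality makes the
words `α γ`, `α ∈ Λ`, distinct, whence `∑_{α ∈ Λ} X_α X_α^* ≤ I`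
(`norm_sum_monomial_mul_adjoint_le_one`). The supremum is attained in the limit `r → 1` at the test
points, where applying the series to `x ⊗ e₁` recovers the column.
-/

namespace Polyball

noncomputable section


/-! ### Finite families of operators -/

section Families

variable {ι : Type*} {E F G : Type*} [NormedAddCommGroup E] [InnerProductSpace ℂ E]
  [NormedAddCommGroup F] [InnerProductSpace ℂ F] [NormedAddCommGroup G] [InnerProductSpace ℂ G]
  [CompleteSpace F] [CompleteSpace G]

theorem sum_norm_sq_eq_re_inner [CompleteSpace E] (s : Finset ι) (T : ι → (E →L[ℂ] F)) (f : E) :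
    ∑ i ∈ s, ‖T i f‖ ^ 2 =
      RCLike.re (inner ℂ f ((∑ i ∈ s, (ContinuousLinearMap.adjoint (T i)).comp (T i)) f)) := by
  rw [sum_apply, inner_sum, map_sum]
  refine Finset.sum_congr rfl fun i _ => ?_
  rw [ContinuousLinearMap.comp_apply, ContinuousLinearMap.adjoint_inner_right,
    inner_self_eq_norm_sq]

theorem re_inner_apply_le (T : E →L[ℂ] E) (f : E) :
    RCLike.re (inner ℂ f (T f)) ≤ ‖T‖ * ‖f‖ ^ 2 := by
  calc RCLike.re (inner ℂ f (T f)) ≤ ‖f‖ * ‖T f‖ := re_inner_le_norm _ _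
    _ ≤ ‖f‖ * (‖T‖ * ‖f‖) := by gcongr; exact T.le_opNorm f
    _ = ‖T‖ * ‖f‖ ^ 2 := by ring

theorem sum_norm_sq_le [CompleteSpace E] (s : Finset ι) (T : ι → (E →L[ℂ] F)) (f : E) :
    ∑ i ∈ s, ‖T i f‖ ^ 2 ≤
      ‖∑ i ∈ s, (ContinuousLinearMap.adjoint (T i)).comp (T i)‖ * ‖f‖ ^ 2 := by
  rw [sum_norm_sq_eq_re_inner]
  exact re_inner_apply_le _ _

/-- Cauchy–Schwarz for the product of a row and a column of operators: the `P i` are the adjoints of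
the entries of the row, the `Q i` are the entries of the column. -/
theorem norm_sum_adjoint_comp_le (s : Finset ι) (P : ι → (F →L[ℂ] G)) (Q : ι → (E →L[ℂ] G))
    {a b : ℝ} (ha : 0 ≤ a) (hb : 0 ≤ b)
    (hP : ∀ g, ∑ i ∈ s, ‖P i g‖ ^ 2 ≤ a ^ 2 * ‖g‖ ^ 2)
    (hQ : ∀ f, ∑ i ∈ s, ‖Q i f‖ ^ 2 ≤ b ^ 2 * ‖f‖ ^ 2) :
    ‖∑ i ∈ s, (ContinuousLinearMap.adjoint (P i)).comp (Q i)‖ ≤ a * b := by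
  refine ContinuousLinearMap.opNorm_le_of_re_inner_le (by positivity) fun f g hf hg => ?_
  rw [sum_apply, sum_inner, map_sum]
  calc ∑ i ∈ s, RCLike.re (inner ℂ (((ContinuousLinearMap.adjoint (P i)).comp (Q i)) f) g)
      ≤ ∑ i ∈ s, ‖Q i f‖ * ‖P i g‖ := by
        refine Finset.sum_le_sum fun i _ => ?_
        rw [ContinuousLinearMap.comp_apply, ContinuousLinearMap.adjoint_inner_left]
        exact re_inner_le_norm _ _
    _ ≤ √(∑ i ∈ s, ‖Q i f‖ ^ 2) * √(∑ i ∈ s, ‖P i g‖ ^ 2) :=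
        Real.sum_mul_le_sqrt_mul_sqrt _ _ _
    _ ≤ √((b * ‖f‖) ^ 2) * √((a * ‖g‖) ^ 2) := by
        rw [mul_pow, mul_pow]
        gcongr
        · exact hQ f
        · exact hP g
    _ = a * b := by
        rw [hf, hg, Real.sqrt_sq (by positivity), Real.sqrt_sq (by positivity)]; ring

/-- A family of operators with pairwise orthogonal values whose finite sums are uniformly bounded
converges in the strong operator topology. -/
theorem exists_hasStrongSum_of_orthogonal (T : ι → (E →L[ℂ] F)) {M : ℝ} (hM : 0 ≤ M)
    (horth : ∀ i j, i ≠ j → ∀ f, inner ℂ (T i f) (T j f) = 0)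
    (hT : ∀ (s : Finset ι) f, ∑ i ∈ s, ‖T i f‖ ^ 2 ≤ M ^ 2 * ‖f‖ ^ 2) :
    ∃ S : E →L[ℂ] F, HasStrongSum T S ∧ ‖S‖ ≤ M := by
  have hnorm : ∀ (s : Finset ι) f, ‖∑ i ∈ s, T i f‖ ^ 2 = ∑ i ∈ s, ‖T i f‖ ^ 2 := by
    intro s f
    classical
    rw [← inner_self_eq_norm_sq (𝕜 := ℂ), sum_inner, map_sum]
    refine Finset.sum_congr rfl fun i hi => ?_
    rw [inner_sum, Finset.sum_eq_single i (fun j _ hj => horth i j hj.symm f)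
      (fun h => absurd hi h), inner_self_eq_norm_sq]
  have hle : ∀ (s : Finset ι) f, ‖∑ i ∈ s, T i f‖ ≤ M * ‖f‖ := by
    intro s f
    refine abs_le_of_sq_le_sq' ?_ (by positivity) |>.2
    rw [hnorm, mul_pow]
    exact hT s f
  have hsum : ∀ f, Summable fun i => T i f := by
    intro f
    have h2 : Summable fun i => ‖T i f‖ ^ 2 :=
      summable_of_sum_le (fun _ => sq_nonneg _) fun s => hT s f
    rw [summable_iff_vanishing_norm]
    intro ε hε
    obtain ⟨s, hs⟩ := summable_iff_vanishing_norm.1 h2 (ε ^ 2) (by positivity)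
    refine ⟨s, fun t ht => ?_⟩
    have := hs t ht
    rw [Real.norm_of_nonneg (Finset.sum_nonneg fun _ _ => sq_nonneg _), ← hnorm] at this
    exact lt_of_pow_lt_pow_left₀ 2 hε.le this
  refine ⟨LinearMap.mkContinuous
    { toFun := fun f => ∑' i, T i f
      map_add' := fun f g => by simp only [map_add]; exact (hsum f).tsum_add (hsum g)
      map_smul' := fun c f => by
        simp only [map_smul, RingHom.id_apply]
        exact (hsum f).tsum_const_smul c }
    M fun f => ?_, fun f => ?_, LinearMap.mkContinuous_norm_le _ hM _⟩
  · exact le_of_tendsto (hsum f).hasSum.norm (Filter.Eventually.of_forall fun s => hle s f)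
  · exact (hsum f).hasSum

end Families

/-! ### Operators on Hilbert tensor products -/

section Tensor

variable {K : Type v} {H : Type u} [NormedAddCommGroup K] [InnerProductSpace ℂ K]
    [NormedAddCommGroup H] [InnerProductSpace ℂ H]

/-- The elementary tensor `x ⊗ h` in the Hilbert space tensor product. -/
def pureTensor (x : K) (h : H) : HilbertTensor K H := ((x ⊗ₜ[ℂ] h : K ⊗[ℂ] H) : HilbertTensor K H)

@[simp]
theorem opTensor_pureTensor (A : K →L[ℂ] K) (X : H →L[ℂ] H) (x : K) (h : H) :
    opTensor A X (pureTensor x h) = pureTensor (A x) (X h) := by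
  simp [opTensor, pureTensor]

@[simp]
theorem inner_pureTensor (x y : K) (g h : H) :
    inner ℂ (pureTensor x g) (pureTensor y h) = inner ℂ x y * inner ℂ g h := by
  simp [pureTensor]

theorem norm_pureTensor (x : K) (h : H) : ‖pureTensor x h‖ = ‖x‖ * ‖h‖ := by
  simp [pureTensor]

theorem pureTensor_sum_left {ι : Type*} (s : Finset ι) (x : ι → K) (h : H) :
    pureTensor (∑ i ∈ s, x i) h = ∑ i ∈ s, pureTensor (x i) h := by
  rw [pureTensor, TensorProduct.sum_tmul]
  exact map_sum (UniformSpace.Completion.toComplL (𝕜 := ℂ) (E := K ⊗[ℂ] H)) _ _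

theorem pureTensor_sum_right {ι : Type*} (s : Finset ι) (x : K) (h : ι → H) :
    pureTensor x (∑ i ∈ s, h i) = ∑ i ∈ s, pureTensor x (h i) := by
  rw [pureTensor, TensorProduct.tmul_sum]
  exact map_sum (UniformSpace.Completion.toComplL (𝕜 := ℂ) (E := K ⊗[ℂ] H)) _ _

theorem ext_pureTensor {F : Type*} [NormedAddCommGroup F] [InnerProductSpace ℂ F]
    {S T : HilbertTensor K H →L[ℂ] F}
    (h : ∀ x g, S (pureTensor x g) = T (pureTensor x g)) : S = T := by
  ext f
  refine UniformSpace.Completion.induction_on f (isClosed_eq S.continuous T.continuous) fun t => ?_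
  induction t using TensorProduct.induction_on with
  | zero => exact (map_zero S).trans (map_zero T).symm
  | tmul x g => exact h x g
  | add a b ha hb => rw [UniformSpace.Completion.coe_add, map_add, map_add, ha, hb]

theorem opTensor_mul (A B : K →L[ℂ] K) (X Y : H →L[ℂ] H) :
    opTensor (A * B) (X * Y) = opTensor A X * opTensor B Y :=
  ext_pureTensor fun x g => by simp

theorem opTensor_sum_left {ι : Type*} (s : Finset ι) (A : ι → (K →L[ℂ] K)) (X : H →L[ℂ] H) :
    opTensor (∑ i ∈ s, A i) X = ∑ i ∈ s, opTensor (A i) X :=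
  ext_pureTensor fun x g => by
    simp only [sum_apply, pureTensor_sum_left, opTensor_pureTensor]

theorem opTensor_sum_right {ι : Type*} (s : Finset ι) (A : K →L[ℂ] K) (X : ι → (H →L[ℂ] H)) :
    opTensor A (∑ i ∈ s, X i) = ∑ i ∈ s, opTensor A (X i) :=
  ext_pureTensor fun x g => by
    simp only [sum_apply, pureTensor_sum_right, opTensor_pureTensor]

theorem opTensor_zero_right (A : K →L[ℂ] K) : opTensor A (0 : H →L[ℂ] H) = 0 := by
  simpa using opTensor_sum_right (∅ : Finset Unit) A (fun _ => (0 : H →L[ℂ] H))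

theorem norm_opTensor_le (A : K →L[ℂ] K) (X : H →L[ℂ] H) : ‖opTensor A X‖ ≤ ‖A‖ * ‖X‖ := by
  refine ContinuousLinearMap.opNorm_le_bound _ (by positivity) fun f => ?_
  refine UniformSpace.Completion.induction_on f (isClosed_le (by fun_prop) (by fun_prop))
    fun t => ?_
  rw [opTensor, ContinuousLinearMap.completion_apply_coe, UniformSpace.Completion.norm_coe,
    UniformSpace.Completion.norm_coe]
  exact (TensorProduct.mapL A X).le_of_opNorm_le (TensorProduct.norm_mapL_le A X) t

variable [CompleteSpace K] [CompleteSpace H]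

theorem adjoint_opTensor (A : K →L[ℂ] K) (X : H →L[ℂ] H) :
    ContinuousLinearMap.adjoint (opTensor A X) =
      opTensor (ContinuousLinearMap.adjoint A) (ContinuousLinearMap.adjoint X) := by
  refine ext_pureTensor fun x g => ?_
  refine ext_inner_right ℂ fun f => ?_
  rw [ContinuousLinearMap.adjoint_inner_left]
  -- both sides are continuous linear functionals of `f`
  suffices h : (innerSL ℂ (pureTensor x g)).comp (opTensor A X) =
      innerSL ℂ (opTensor (ContinuousLinearMap.adjoint A) (ContinuousLinearMap.adjoint X)
        (pureTensor x g)) from DFunLike.congr_fun h f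
  refine ext_pureTensor fun y h => ?_
  simp [ContinuousLinearMap.adjoint_inner_left]

/-- A column bound for the coefficients is inherited by their ampliations. -/
theorem sum_norm_sq_opTensor_one_le {ι : Type*} (s : Finset ι) (A : ι → (K →L[ℂ] K)) {M : ℝ}
    (hM : 0 ≤ M) (hA : ∀ x, ∑ i ∈ s, ‖A i x‖ ^ 2 ≤ M ^ 2 * ‖x‖ ^ 2) (f : HilbertTensor K H) :
    ∑ i ∈ s, ‖opTensor (A i) 1 f‖ ^ 2 ≤ M ^ 2 * ‖f‖ ^ 2 := by
  refine (sum_norm_sq_le s _ f).trans ?_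
  gcongr
  have h : ∑ i ∈ s, (ContinuousLinearMap.adjoint (opTensor (A i) (1 : H →L[ℂ] H))).comp
      (opTensor (A i) 1) =
      opTensor (∑ i ∈ s, (ContinuousLinearMap.adjoint (A i)).comp (A i)) 1 := by
    rw [opTensor_sum_left]
    refine Finset.sum_congr rfl fun i _ => ext_pureTensor fun x g => ?_
    rw [adjoint_opTensor]
    simp [← ContinuousLinearMap.star_eq_adjoint]
  rw [h]
  calc _ ≤ _ := norm_opTensor_le _ _
    _ ≤ (M * M) * 1 := by
      gcongr
      · exact norm_sum_adjoint_comp_le s A A hM hM hA hA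
      · exact ContinuousLinearMap.norm_id_le
    _ = M ^ 2 := by ring

/-- `∑ Aᵢ ⊗ Xᵢ` is the product of the row `(1 ⊗ Xᵢ)` and the column `(Aᵢ ⊗ 1)`. -/
theorem norm_sum_opTensor_le {ι : Type*} (s : Finset ι) (A : ι → (K →L[ℂ] K))
    (X : ι → (H →L[ℂ] H)) {M : ℝ}
    (hM : 0 ≤ M) (hA : ∀ x, ∑ i ∈ s, ‖A i x‖ ^ 2 ≤ M ^ 2 * ‖x‖ ^ 2) :
    ‖∑ i ∈ s, opTensor (A i) (X i)‖ ≤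
      √‖∑ i ∈ s, X i * ContinuousLinearMap.adjoint (X i)‖ * M := by
  have h : ∑ i ∈ s, opTensor (A i) (X i) = ∑ i ∈ s, (ContinuousLinearMap.adjoint
      (opTensor (1 : K →L[ℂ] K) (ContinuousLinearMap.adjoint (X i)))).comp (opTensor (A i) 1) := by
    refine Finset.sum_congr rfl fun i _ => ext_pureTensor fun x g => ?_
    rw [adjoint_opTensor]
    simp [← ContinuousLinearMap.star_eq_adjoint]
  rw [h]
  refine norm_sum_adjoint_comp_le s _ _ (Real.sqrt_nonneg _) hM (fun g => ?_)
    (sum_norm_sq_opTensor_one_le s A hM hA)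
  rw [Real.sq_sqrt (norm_nonneg _)]
  refine (sum_norm_sq_le s _ g).trans ?_
  gcongr
  have h : ∑ i ∈ s, (ContinuousLinearMap.adjoint
      (opTensor (1 : K →L[ℂ] K) (ContinuousLinearMap.adjoint (X i)))).comp
        (opTensor (1 : K →L[ℂ] K) (ContinuousLinearMap.adjoint (X i))) =
      opTensor (1 : K →L[ℂ] K) (∑ i ∈ s, X i * ContinuousLinearMap.adjoint (X i)) := by
    rw [opTensor_sum_right]
    refine Finset.sum_congr rfl fun i _ => ext_pureTensor fun x g => ?_
    rw [adjoint_opTensor]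
    simp [← ContinuousLinearMap.star_eq_adjoint]
  rw [h]
  refine (norm_opTensor_le _ _).trans ?_
  exact mul_le_of_le_one_left (norm_nonneg _) ContinuousLinearMap.norm_id_le

end Tensor


/-! ### Words and monomials -/

section Words

variable {k : ℕ} {n : Fin k → ℕ}

/-- Two ordered products can be multiplied factor by factor if factors with different indices
commute. Nothing is asked of factors with the same index. -/
theorem list_ofFn_mul_prod {M : Type*} [Monoid M] {k : ℕ} (f g : Fin k → M)
    (h : ∀ i j, i ≠ j → Commute (f i) (g j)) :
    (List.ofFn f).prod * (List.ofFn g).prod = (List.ofFn fun i => f i * g i).prod := by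
  induction k with
  | zero => simp
  | succ k ih =>
    have hc : Commute (List.ofFn fun i : Fin k => f i.succ).prod (g 0) := by
      refine Commute.list_prod_left _ _ fun x hx => ?_
      obtain ⟨i, rfl⟩ := List.mem_ofFn.1 hx
      exact h _ _ (Fin.succ_ne_zero i)
    rw [List.ofFn_succ, List.ofFn_succ, List.ofFn_succ, List.prod_cons, List.prod_cons,
      List.prod_cons, ← ih (fun i => f i.succ) (fun i => g i.succ)
        (fun i j hij => h _ _ fun e => hij (Fin.succ_injective _ e)),
      mul_assoc, ← mul_assoc _ (g 0), hc.eq]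
    simp only [mul_assoc]

theorem commute_lift {m m' : ℕ} {M : Type*} [Monoid M] {f : Fin m → M} {g : Fin m' → M}
    (h : ∀ a b, Commute (f a) (g b)) (α : FreeMonoid (Fin m)) (β : FreeMonoid (Fin m')) :
    Commute (FreeMonoid.lift f α) (FreeMonoid.lift g β) := by
  rw [FreeMonoid.lift_apply, FreeMonoid.lift_apply]
  refine Commute.list_prod_left _ _ fun x hx => Commute.list_prod_right _ _ fun y hy => ?_
  obtain ⟨a, -, rfl⟩ := List.mem_map.1 hx
  obtain ⟨b, -, rfl⟩ := List.mem_map.1 hy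
  exact h a b

variable {H : Type u} [NormedAddCommGroup H] [InnerProductSpace ℂ H]

theorem monomial_mul {X : OpTuple n H} (h : ∀ s t, s ≠ t → ∀ a b, Commute (X s a) (X t b))
    (α β : Word n) : monomial X (α * β) = monomial X α * monomial X β := by
  rw [monomial, monomial, monomial, list_ofFn_mul_prod _ _ fun i j hij =>
    commute_lift (h i j hij) _ _]
  simp only [Pi.mul_apply, map_mul]

/-- The total length `|α₁| + ⋯ + |α_k|` of a word. -/
def totalLength (α : Word n) : ℕ := (List.ofFn fun i => (α i).length).sum

/-- A tuple that acts on an orthonormal family `(e_α)` like the creation operators, up to a scalar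
`c`, has monomials that do so too, up to a power of `c`. -/
theorem monomial_apply_of_creation {X : OpTuple n H} {e : Word n → H} {c : ℂ}
    (hX : ∀ i j α, X i j (e α) = c • e (prependLetter i j α)) (α γ : Word n) :
    monomial X α (e γ) = c ^ totalLength α • e (α * γ) := by
  have hl : ∀ i (w : FreeMonoid (Fin (n i))) γ, FreeMonoid.lift (X i) w (e γ) =
      c ^ w.length • e (Function.update γ i (w * γ i)) := by
    intro i w
    induction w using FreeMonoid.inductionOn' with
    | one => intro γ; simp
    | of_mul a w ih =>
      intro γ
      rw [map_mul, mul_apply_eq_comp, ih, map_smul, FreeMonoid.lift_eval_of, hX,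
        smul_smul, FreeMonoid.length_mul, FreeMonoid.length_of, add_comm, pow_succ]
      simp [prependLetter, mul_assoc]
  -- the rows are applied one after the other, from the last to the first
  have hlist : ∀ (l : List (Fin k)), l.Nodup → ∀ γ,
      (l.map fun i => FreeMonoid.lift (X i) (α i)).prod (e γ) =
        c ^ (l.map fun i => (α i).length).sum • e (fun i => if i ∈ l then α i * γ i else γ i) := by
    intro l
    induction l with
    | nil => intro _ γ; simp
    | cons i l ih =>
      intro hl' γ
      rw [List.nodup_cons] at hl'
      rw [List.map_cons, List.prod_cons, mul_apply_eq_comp, ih hl'.2, map_smul, hl,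
        smul_smul, List.map_cons, List.sum_cons, add_comm, pow_add]
      congr 2
      funext t
      by_cases ht : t = i
      · subst ht; simp [hl'.1]
      · simp [ht]
  have := hlist (List.finRange k) (List.nodup_finRange k) γ
  rw [monomial, totalLength, List.ofFn_eq_map, List.ofFn_eq_map, this]
  congr 2
  funext t
  simp

theorem monomial_universalModel_fockBasis (α γ : Word n) :
    monomial (universalModel n) α (fockBasis γ) = fockBasis (α * γ) := by
  rw [monomial_apply_of_creation (c := 1) (e := fockBasis)
    (fun i j α => by rw [universalModel_fockBasis, one_smul])]
  simp

theorem norm_monomial_le_one {X : OpTuple n H} (h : ∀ i j, ‖X i j‖ ≤ 1) (α : Word n) :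
    ‖monomial X α‖ ≤ 1 := by
  have hl : ∀ l : List (H →L[ℂ] H), (∀ T ∈ l, ‖T‖ ≤ 1) → ‖l.prod‖ ≤ 1 := by
    intro l
    induction l with
    | nil => intro _; exact ContinuousLinearMap.norm_id_le
    | cons T l ih =>
      intro hl
      rw [List.prod_cons]
      refine (norm_mul_le _ _).trans (mul_le_one₀ (hl T (by simp)) (norm_nonneg _) ?_)
      exact ih fun S hS => hl S (by simp [hS])
  refine hl _ fun T hT => ?_
  obtain ⟨i, rfl⟩ := List.mem_ofFn.1 hT
  rw [FreeMonoid.lift_apply]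
  refine hl _ fun S hS => ?_
  obtain ⟨a, -, rfl⟩ := List.mem_map.1 hS
  exact h i a

/-- Words in an orthogonal set have no common left multiples. -/
theorem IsOrthogonalSet.mul_injOn {Λ : Set (Word n)} (hΛ : IsOrthogonalSet Λ) {α β : Word n}
    (hα : α ∈ Λ) (hβ : β ∈ Λ) {γ δ : Word n} (h : α * γ = β * δ) : α = β ∧ γ = δ := by
  have hαβ : α = β := by
    by_contra hne
    have h0 := hΛ α hα β hβ hne
    have : inner ℂ (monomial (universalModel n) β (fockBasis δ))
        (monomial (universalModel n) α (fockBasis γ)) = 0 := by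
      rw [← ContinuousLinearMap.adjoint_inner_right, ← mul_apply_eq_comp, h0]
      simp
    rw [monomial_universalModel_fockBasis, monomial_universalModel_fockBasis, h,
      inner_self_eq_norm_sq_to_K, orthonormal_fockBasis.1] at this
    simp at this
  subst hαβ
  refine ⟨rfl, funext fun i => ?_⟩
  exact mul_left_cancel (congrFun h i)

theorem rightLE_iff {ω γ : Word n} : RightLE ω γ ↔ ∃ α : Word n, γ = α * ω := by
  refine ⟨fun h => ?_, fun ⟨α, h⟩ i => ⟨α i, by rw [h]; rfl⟩⟩
  choose α hα using h
  exact ⟨α, funext hα⟩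

end Words


/-! ### Operator identities on the regular polyball -/

section Berezin

variable {k : ℕ} {n : Fin k → ℕ}
variable {H : Type u} [NormedAddCommGroup H] [InnerProductSpace ℂ H] [CompleteSpace H]

/-- The map `Y ↦ Z Y Z^*`, as a monoid homomorphism in `Z`. -/
def conjMap : (H →L[ℂ] H) →* Module.End ℂ (H →L[ℂ] H) where
  toFun Z := LinearMap.mulLeft ℂ Z ∘ₗ LinearMap.mulRight ℂ (ContinuousLinearMap.adjoint Z)
  map_one' := by
    ext Y : 1
    simp [← ContinuousLinearMap.star_eq_adjoint]
  map_mul' Z W := by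
    ext Y : 1
    simp [← ContinuousLinearMap.star_eq_adjoint, mul_assoc]

theorem conjMap_apply (Z Y : H →L[ℂ] H) :
    conjMap Z Y = Z * Y * ContinuousLinearMap.adjoint Z := by
  simp [conjMap, mul_assoc]

theorem conjMap_nonneg (Z : H →L[ℂ] H) {Y : H →L[ℂ] H} (hY : 0 ≤ Y) : 0 ≤ conjMap Z Y := by
  rw [conjMap_apply]
  exact star_right_conjugate_nonneg hY Z

theorem rowMap_eq_sum_conjMap {m : ℕ} (Xi : Fin m → (H →L[ℂ] H)) :
    rowMap Xi = ∑ j, conjMap (Xi j) := rfl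

theorem rowMap_pow {m : ℕ} (Xi : Fin m → (H →L[ℂ] H)) (l : ℕ) :
    rowMap Xi ^ l = ∑ w ∈ wordsOfLength m l, conjMap (FreeMonoid.lift Xi w) := by
  have h := (MultilinearMap.mkPiAlgebraFin ℂ l (Module.End ℂ (H →L[ℂ] H))).map_sum
    (fun _ (j : Fin m) => conjMap (Xi j))
  rw [MultilinearMap.mkPiAlgebraFin_apply_const, ← rowMap_eq_sum_conjMap] at h
  rw [h, wordsOfLength, Finset.sum_map]
  refine Finset.sum_congr rfl fun a _ => ?_
  have ha : FreeMonoid.lift Xi (FreeMonoid.ofList (List.ofFn a)) =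
      (List.ofFn fun i => Xi (a i)).prod := by
    rw [FreeMonoid.lift_ofList, List.map_ofFn]
    rfl
  exact Eq.symm <| (congrArg conjMap ha).trans <| by
    rw [map_list_prod, List.map_ofFn]
    rfl

open Classical in
/-- The words all of whose components have length less than `N`. -/
def wordBox (n : Fin k → ℕ) (N : ℕ) : Finset (Word n) :=
  Fintype.piFinset fun i => (Finset.range N).biUnion (wordsOfLength (n i))

theorem mem_wordBox {N : ℕ} {α : Word n} : α ∈ wordBox n N ↔ ∀ i, (α i).length < N := by
  simp [wordBox, mem_wordsOfLength]

theorem tendsto_wordBox : Filter.Tendsto (wordBox n) Filter.atTop Filter.atTop := by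
  refine Filter.tendsto_atTop_finset_of_monotone (fun N N' h α hα => ?_) fun α => ?_
  · rw [mem_wordBox] at *
    exact fun i => (hα i).trans_le h
  · refine ⟨∑ i, (α i).length + 1, mem_wordBox.2 fun i => Nat.lt_succ_of_le ?_⟩
    exact Finset.single_le_sum (f := fun i => (α i).length) (fun _ _ => Nat.zero_le _)
      (Finset.mem_univ i)

/-- Summing `X_γ Y X_γ^*` over a box of words amounts to applying truncated geometric series of the
row maps. -/
theorem sum_wordBox_conjMap (X : OpTuple n H) (N : ℕ) :
    ∑ γ ∈ wordBox n N, conjMap (monomial X γ) =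
      (List.ofFn fun i => ∑ l ∈ Finset.range N, rowMap (X i) ^ l).prod := by
  classical
  have h := (MultilinearMap.mkPiAlgebraFin ℂ k (Module.End ℂ (H →L[ℂ] H))).map_sum_finset
    (fun i (w : FreeMonoid (Fin (n i))) => conjMap (FreeMonoid.lift (X i) w))
    (fun i => (Finset.range N).biUnion (wordsOfLength (n i)))
  rw [MultilinearMap.mkPiAlgebraFin_apply] at h
  simp only [rowMap_pow]
  rw [wordBox]
  refine Eq.trans ?_ (h.symm.trans ?_)
  · refine Finset.sum_congr rfl fun γ _ => ?_
    simp [monomial, map_list_prod, List.map_ofFn, Function.comp_def]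
  · congr 2
    funext i
    refine Finset.sum_biUnion fun a _ b _ hab => ?_
    refine Finset.disjoint_left.2 fun w hw hw' => hab ?_
    rw [mem_wordsOfLength] at hw hw'
    exact hw.symm.trans hw'

/-- The map `Φ` of a row is bounded by the norm of its value at the identity. -/
theorem norm_rowMap_apply_le {m : ℕ} (Xi : Fin m → (H →L[ℂ] H)) (Y : H →L[ℂ] H) :
    ‖rowMap Xi Y‖ ≤ ‖∑ j, Xi j * ContinuousLinearMap.adjoint (Xi j)‖ * ‖Y‖ := by
  set ρ := ‖∑ j, Xi j * ContinuousLinearMap.adjoint (Xi j)‖ with hρ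
  have h1 : ∀ g, ∑ j, ‖ContinuousLinearMap.adjoint (Xi j) g‖ ^ 2 ≤ √ρ ^ 2 * ‖g‖ ^ 2 := by
    intro g
    have := sum_norm_sq_le Finset.univ (fun j => ContinuousLinearMap.adjoint (Xi j)) g
    simp only [ContinuousLinearMap.adjoint_adjoint] at this
    rw [Real.sq_sqrt (norm_nonneg _)]
    exact this
  have h2 := norm_sum_adjoint_comp_le Finset.univ
    (fun j => ContinuousLinearMap.adjoint (Xi j))
    (fun j => Y.comp (ContinuousLinearMap.adjoint (Xi j))) (a := √ρ) (b := ‖Y‖ * √ρ)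
    (by positivity) (by positivity) h1 (fun f => ?_)
  · rw [mul_left_comm, Real.mul_self_sqrt (norm_nonneg _), mul_comm] at h2
    refine le_trans (le_of_eq ?_) h2
    rw [rowMap_eq_sum_conjMap, LinearMap.sum_apply]
    simp only [conjMap_apply, ContinuousLinearMap.adjoint_adjoint]
    rfl
  · rw [mul_pow, mul_assoc]
    refine le_trans ?_ (mul_le_mul_of_nonneg_left (h1 f) (sq_nonneg ‖Y‖))
    rw [Finset.mul_sum]
    refine Finset.sum_le_sum fun j _ => ?_
    rw [← mul_pow]
    gcongr
    exact Y.le_opNorm _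

/-- The map `Φ` of a row of operators as an element of a Banach algebra. -/
def rowMapL {m : ℕ} (Xi : Fin m → (H →L[ℂ] H)) : (H →L[ℂ] H) →L[ℂ] (H →L[ℂ] H) :=
  (rowMap Xi).mkContinuous _ (norm_rowMap_apply_le Xi)

theorem norm_rowMapL_lt_one {m : ℕ} {Xi : Fin m → (H →L[ℂ] H)}
    (h : ‖∑ j, Xi j * ContinuousLinearMap.adjoint (Xi j)‖ < 1) : ‖rowMapL Xi‖ < 1 :=
  (LinearMap.mkContinuous_norm_le _ (norm_nonneg _) _).trans_lt h

theorem toLinearMap_list_ofFn_prod (f : Fin k → ((H →L[ℂ] H) →L[ℂ] (H →L[ℂ] H))) :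
    ((List.ofFn f).prod : (H →L[ℂ] H) →L[ℂ] (H →L[ℂ] H)).toLinearMap =
      (List.ofFn fun i => (f i).toLinearMap).prod := by
  have := map_list_prod (ContinuousLinearMap.toLinearMapRingHom (R₁ := ℂ) (M₁ := H →L[ℂ] H))
    (List.ofFn f)
  rw [List.map_ofFn] at this
  exact this

theorem defectMap_apply_eq (X : OpTuple n H) (Y : H →L[ℂ] H) :
    defectMap X Y = (List.ofFn fun i => 1 - rowMapL (X i)).prod Y := by
  rw [← ContinuousLinearMap.coe_coe, toLinearMap_list_ofFn_prod]
  rfl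

theorem sum_wordBox_apply (X : OpTuple n H) (N : ℕ) (Y : H →L[ℂ] H) :
    ∑ γ ∈ wordBox n N, conjMap (monomial X γ) Y =
      (List.ofFn fun i => ∑ l ∈ Finset.range N, rowMapL (X i) ^ l).prod Y := by
  rw [← ContinuousLinearMap.coe_coe, toLinearMap_list_ofFn_prod, ← LinearMap.sum_apply,
    sum_wordBox_conjMap]
  congr 3
  funext i
  have := map_sum (ContinuousLinearMap.toLinearMapRingHom (R₁ := ℂ) (M₁ := H →L[ℂ] H))
    (fun l => rowMapL (X i) ^ l) (Finset.range N)
  simp only [map_pow] at this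
  exact this.symm

theorem tendsto_list_ofFn_prod {A : Type*} [NormedRing A] [NormedAlgebra ℂ A]
    {f : ℕ → Fin k → A} {g : Fin k → A}
    (h : ∀ i, Filter.Tendsto (fun N => f N i) Filter.atTop (nhds (g i))) :
    Filter.Tendsto (fun N => (List.ofFn (f N)).prod) Filter.atTop (nhds (List.ofFn g).prod) :=
  ((ContinuousMultilinearMap.mkPiAlgebraFin ℂ k A).cont.tendsto g).comp (tendsto_pi_nhds.2 h)

/-- A family of positive operators whose sums over the boxes of words converge in norm is
summable. -/
theorem hasSum_of_tendsto_wordBox {f : Word n → (H →L[ℂ] H)} (hf : ∀ α, 0 ≤ f α) {L : H →L[ℂ] H}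
    (hL : Filter.Tendsto (fun N => ∑ α ∈ wordBox n N, f α) Filter.atTop (nhds L)) :
    HasSum f L := by
  classical
  -- a finite sum outside a box is dominated by the difference of two box sums
  have hs : Summable f := by
    rw [summable_iff_vanishing_norm]
    intro ε hε
    obtain ⟨N₀, hN₀⟩ := Metric.cauchySeq_iff.1 hL.cauchySeq ε hε
    refine ⟨wordBox n N₀, fun t ht => ?_⟩
    obtain ⟨N, hN, htN⟩ := ((Filter.eventually_ge_atTop N₀).and
      (tendsto_wordBox.eventually_ge_atTop (t ∪ wordBox n N₀))).exists
    have hdist := hN₀ N hN N₀ le_rfl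
    rw [dist_eq_norm] at hdist
    refine lt_of_le_of_lt ?_ hdist
    refine CStarAlgebra.norm_le_norm_of_nonneg_of_le (Finset.sum_nonneg fun α _ => hf α) ?_
    rw [le_sub_iff_add_le, ← Finset.sum_union ht]
    exact Finset.sum_le_sum_of_subset_of_nonneg htN fun α _ _ => hf α
  have := tendsto_nhds_unique (hs.hasSum.comp tendsto_wordBox) hL
  exact this ▸ hs.hasSum

variable {X : OpTuple n H}

/-- Only the strict contractivity of the rows enters: the geometric series of the row maps converge
in norm. -/
theorem summable_monomial_mul_adjoint (hX : X ∈ regularPolyball n H) :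
    Summable fun α => monomial X α * ContinuousLinearMap.adjoint (monomial X α) := by
  have hconj : ∀ α, monomial X α * ContinuousLinearMap.adjoint (monomial X α) =
      conjMap (monomial X α) 1 := fun α => by rw [conjMap_apply, mul_one]
  simp only [hconj]
  have hlim := tendsto_list_ofFn_prod
    (f := fun N i => ∑ l ∈ Finset.range N, rowMapL (X i) ^ l)
    fun i => (summable_geometric_of_norm_lt_one
      (norm_rowMapL_lt_one (hX.2.1 i))).hasSum.tendsto_sum_nat
  have hlim' := ((ContinuousLinearMap.apply ℂ (H →L[ℂ] H) (1 : H →L[ℂ] H)).continuous.tendsto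
    _).comp hlim
  refine (hasSum_of_tendsto_wordBox (fun α => conjMap_nonneg _ zero_le_one)
    (hlim'.congr fun N => ?_)).summable
  rw [sum_wordBox_apply]
  rfl

theorem commute_rowMapL (h : ∀ s t, s ≠ t → ∀ a b, Commute (X s a) (X t b)) {s t : Fin k}
    (hst : s ≠ t) : Commute (rowMapL (X s)) (rowMapL (X t)) := by
  have h' : Commute (rowMap (X s)) (rowMap (X t)) := by
    rw [rowMap_eq_sum_conjMap, rowMap_eq_sum_conjMap]
    exact Commute.sum_left _ _ _ fun a _ => Commute.sum_right _ _ _ fun b _ =>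
      (h s t hst a b).map conjMap
  ext Y : 1
  exact LinearMap.congr_fun h' Y

/-- The reproducing identity `∑_γ X_γ Δ_X(I) X_γ^* = I`: the truncated geometric series of the row
maps inverts the defect map up to powers of the row maps, which tend to zero in norm. -/
theorem hasSum_monomial_defect (hX : X ∈ regularPolyball n H) :
    HasSum (fun γ => conjMap (monomial X γ) (defectMap X 1)) 1 := by
  refine hasSum_of_tendsto_wordBox (fun γ => conjMap_nonneg _ hX.2.2.nonneg) ?_
  have hlim := tendsto_list_ofFn_prod (g := fun _ : Fin k => 1)
    (f := fun N i => 1 - rowMapL (X i) ^ N) fun i => by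
      simpa using (tendsto_pow_atTop_nhds_zero_of_norm_lt_one
        (norm_rowMapL_lt_one (hX.2.1 i))).const_sub 1
  have hlim' := ((ContinuousLinearMap.apply ℂ (H →L[ℂ] H) (1 : H →L[ℂ] H)).continuous.tendsto
    _).comp hlim
  have hone : (List.ofFn fun _ : Fin k => (1 : (H →L[ℂ] H) →L[ℂ] (H →L[ℂ] H))).prod = 1 :=
    List.prod_eq_one fun x hx => by obtain ⟨i, rfl⟩ := List.mem_ofFn.1 hx; rfl
  rw [hone] at hlim'
  refine hlim'.congr fun N => ?_
  rw [sum_wordBox_apply, defectMap_apply_eq, ← mul_apply_eq_comp,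
    list_ofFn_mul_prod]
  · simp only [geom_sum_mul_neg]
    rfl
  · intro i j hij
    have hc := commute_rowMapL hX.1 hij
    exact Commute.sum_left _ _ _ fun l _ => ((Commute.one_right _).sub_right hc).pow_left l

/-- On the regular polyball, the monomials of an orthogonal set form a row contraction. -/
theorem norm_sum_monomial_mul_adjoint_le_one (hX : X ∈ regularPolyball n H) {Λ : Set (Word n)}
    (hΛ : IsOrthogonalSet Λ) (s : Finset Λ) :
    ‖∑ α ∈ s, monomial X α * ContinuousLinearMap.adjoint (monomial X α)‖ ≤ 1 := by
  classical
  have hsum := hasSum_monomial_defect hX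
  set f : Word n → (H →L[ℂ] H) := fun γ => conjMap (monomial X γ) (defectMap X 1) with hf
  have hf0 : ∀ γ, 0 ≤ f γ := fun γ => conjMap_nonneg _ hX.2.2.nonneg
  have h1 : ∀ α : Word n, HasSum (fun γ => f (α * γ))
      (monomial X α * ContinuousLinearMap.adjoint (monomial X α)) := by
    intro α
    have := (hsum.mul_left (monomial X α)).mul_right (ContinuousLinearMap.adjoint (monomial X α))
    rw [mul_one] at this
    refine this.congr_fun fun γ => ?_
    rw [← conjMap_apply, hf]
    simp only [monomial_mul hX.1, map_mul]
    rfl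
  have h2 := hasSum_sum (s := s) fun α _ => h1 α
  have hle : ∑ α ∈ s, monomial X α * ContinuousLinearMap.adjoint (monomial X α) ≤ 1 := by
    refine le_of_tendsto h2 (Filter.Eventually.of_forall fun t => ?_)
    rw [Finset.sum_comm, ← Finset.sum_product' s t (fun α γ => f (α * γ))]
    -- orthogonality makes `(α, γ) ↦ α γ` injective on `Λ × 𝔽⁺`
    have hinj : Set.InjOn (fun p : Λ × Word n => (p.1 : Word n) * p.2) (s ×ˢ t : Finset _) := by
      rintro ⟨α, γ⟩ - ⟨β, δ⟩ - h
      obtain ⟨h1, h2⟩ := hΛ.mul_injOn α.2 β.2 h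
      exact Prod.ext (Subtype.ext h1) h2
    rw [← Finset.sum_image (f := f) hinj]
    exact sum_le_hasSum _ (fun γ _ => hf0 γ) hsum
  refine (CStarAlgebra.norm_le_norm_of_nonneg_of_le ?_ hle).trans ContinuousLinearMap.norm_id_le
  exact Finset.sum_nonneg fun α _ => mul_star_self_nonneg _

end Berezin


/-! ### Points of the regular polyball modelled on the creation operators -/

section DoublyCommuting

variable {k : ℕ} {n : Fin k → ℕ}
variable {H : Type u} [NormedAddCommGroup H] [InnerProductSpace ℂ H] [CompleteSpace H]

theorem isStrictlyPositive_one_sub {Q : H →L[ℂ] H} (h0 : 0 ≤ Q) (h1 : ‖Q‖ < 1) :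
    IsStrictlyPositive (1 - Q) := by
  refine IsUnit.isStrictlyPositive (isUnit_one_sub_of_norm_lt_one h1) ?_
  rw [sub_nonneg]
  exact (CStarAlgebra.norm_le_one_iff_of_nonneg Q h0).1 h1.le

/-- For rows that doubly commute, the defect operator is the product of the commuting defects
`1 - ∑_j X_{i,j} X_{i,j}^*` of the rows, so being a tuple of strict row contractions suffices. -/
theorem mem_regularPolyball_of_doublyCommuting {X : OpTuple n H}
    (h1 : ∀ s t, s ≠ t → ∀ a b, Commute (X s a) (X t b))
    (h2 : ∀ s t, s ≠ t → ∀ a b, Commute (X s a) (ContinuousLinearMap.adjoint (X t b)))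
    (h3 : ∀ i, ‖∑ j, X i j * ContinuousLinearMap.adjoint (X i j)‖ < 1) :
    X ∈ regularPolyball n H := by
  refine ⟨h1, h3, ?_⟩
  set Q : Fin k → (H →L[ℂ] H) := fun i => ∑ j, X i j * ContinuousLinearMap.adjoint (X i j) with hQ
  have hQ0 : ∀ i, 0 ≤ Q i := fun i => Finset.sum_nonneg fun j _ => mul_star_self_nonneg _
  have hXQ : ∀ s t, s ≠ t → ∀ a, Commute (X s a) (Q t) := fun s t hst a =>
    Commute.sum_right _ _ _ fun b _ => (h1 s t hst a b).mul_right (h2 s t hst a b)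
  have hQQ : ∀ s t, s ≠ t → Commute (Q s) (Q t) := by
    intro s t hst
    refine Commute.sum_left _ _ _ fun a _ => (hXQ s t hst a).mul_left ?_
    have := (hXQ s t hst a).star_star
    rwa [((IsSelfAdjoint.of_nonneg (hQ0 t)).star_eq)] at this
  -- `Φ_i(D) = D Q_i` for an operator `D` that commutes with the entries of the `i`-th row
  have key : ∀ l : List (Fin k), l.Nodup →
      (l.map fun i => 1 - rowMap (X i)).prod 1 = (l.map fun i => 1 - Q i).prod ∧
      IsStrictlyPositive (l.map fun i => 1 - Q i).prod := by
    intro l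
    induction l with
    | nil =>
      intro _
      exact ⟨rfl, IsUnit.isStrictlyPositive isUnit_one zero_le_one⟩
    | cons i l ih =>
      intro hl
      rw [List.nodup_cons] at hl
      obtain ⟨ih1, ih2⟩ := ih hl.2
      set D := (l.map fun i => 1 - Q i).prod with hD
      have hne : ∀ t ∈ l, i ≠ t := fun t ht h => hl.1 (h ▸ ht)
      have hXD : ∀ j, Commute (X i j) D := fun j =>
        Commute.list_prod_right _ _ fun T hT => by
          obtain ⟨t, ht, rfl⟩ := List.mem_map.1 hT
          exact (Commute.one_right _).sub_right (hXQ i t (hne t ht) j)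
      have hQD : Commute (1 - Q i) D :=
        Commute.list_prod_right _ _ fun T hT => by
          obtain ⟨t, ht, rfl⟩ := List.mem_map.1 hT
          exact (Commute.one_left _).sub_left
            ((Commute.one_right _).sub_right (hQQ i t (hne t ht)))
      have hrow : rowMap (X i) D = D * Q i := by
        rw [rowMap_eq_sum_conjMap, LinearMap.sum_apply, hQ, Finset.mul_sum]
        refine Finset.sum_congr rfl fun j _ => ?_
        rw [conjMap_apply, (hXD j).eq, mul_assoc]
      rw [List.map_cons, List.prod_cons, List.map_cons, List.prod_cons, Module.End.mul_apply, ih1]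
      refine ⟨?_, ?_⟩
      · rw [LinearMap.sub_apply, Module.End.one_apply, hrow, hQD.eq, mul_sub, mul_one]
      · exact (IsStrictlyPositive.commute_iff (isStrictlyPositive_one_sub (hQ0 i) (h3 i)) ih2).1 hQD
  have := key (List.finRange k) (List.nodup_finRange k)
  rw [defectMap, List.ofFn_eq_map, this.1]
  exact this.2

end DoublyCommuting

section Model

variable {k : ℕ} {n : Fin k → ℕ}

theorem ext_fockBasis {F : Type*} [NormedAddCommGroup F] [InnerProductSpace ℂ F]
    {S T : Fock n →L[ℂ] F} (h : ∀ α, S (fockBasis α) = T (fockBasis α)) : S = T := by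
  classical
  refine lp.ext_continuousLinearMap ENNReal.ofNat_ne_top fun α => ?_
  ext
  exact h α

theorem ext_inner_fockBasis {f g : Fock n} (h : ∀ α, inner ℂ (fockBasis α) f =
    inner ℂ (fockBasis α) g) : f = g := by
  classical
  ext α
  simpa [fockBasis, lp.inner_single_left] using h α

theorem mem_range_prependLetter {i : Fin k} {j : Fin (n i)} {α : Word n} :
    α ∈ Set.range (prependLetter i j) ↔ ∃ w, α i = FreeMonoid.of j * w := by
  refine ⟨?_, fun ⟨w, hw⟩ => ⟨Function.update α i w, ?_⟩⟩
  · rintro ⟨β, rfl⟩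
    exact ⟨β i, by simp [prependLetter]⟩
  · simp [prependLetter, ← hw]

theorem prependLetter_comm {i l : Fin k} (h : i ≠ l) (j : Fin (n i)) (m : Fin (n l))
    (α : Word n) : prependLetter i j (prependLetter l m α) =
      prependLetter l m (prependLetter i j α) := by
  simp only [prependLetter, Function.update_of_ne h, Function.update_of_ne h.symm]
  exact Function.update_comm h.symm _ _ _

theorem inner_universalModel (i : Fin k) (j : Fin (n i)) (f g : Fock n) :
    inner ℂ (universalModel n i j f) (universalModel n i j g) = inner ℂ f g :=
  (orthogonalFamily_prepend i j).linearIsometry.inner_map_map f g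

theorem adjoint_universalModel_mul_self (i : Fin k) (j : Fin (n i)) :
    ContinuousLinearMap.adjoint (universalModel n i j) * universalModel n i j = 1 := by
  refine ContinuousLinearMap.ext fun f => ext_inner_left ℂ fun g => ?_
  rw [mul_apply_eq_comp, ContinuousLinearMap.adjoint_inner_right, inner_universalModel]
  rfl

theorem norm_universalModel_le_one (i : Fin k) (j : Fin (n i)) : ‖universalModel n i j‖ ≤ 1 :=
  (orthogonalFamily_prepend i j).linearIsometry.norm_toContinuousLinearMap_le

theorem adjoint_universalModel_eq_zero {i : Fin k} {j : Fin (n i)} {α : Word n}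
    (h : α ∉ Set.range (prependLetter i j)) :
    ContinuousLinearMap.adjoint (universalModel n i j) (fockBasis α) = 0 := by
  refine ext_inner_fockBasis fun β => ?_
  rw [ContinuousLinearMap.adjoint_inner_right, universalModel_fockBasis, inner_zero_right]
  exact orthonormal_fockBasis.2 fun e => h ⟨β, e⟩

theorem adjoint_universalModel_mul_of_ne (i : Fin k) {j l : Fin (n i)} (h : j ≠ l) :
    ContinuousLinearMap.adjoint (universalModel n i j) * universalModel n i l = 0 := by
  refine ext_fockBasis fun α => ?_
  rw [mul_apply_eq_comp, universalModel_fockBasis, adjoint_universalModel_eq_zero]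
  · rfl
  · rw [mem_range_prependLetter]
    rintro ⟨w, hw⟩
    simp only [prependLetter, Function.update_self] at hw
    exact h (List.cons.inj hw).1.symm

theorem commute_universalModel {s t : Fin k} (h : s ≠ t) (a : Fin (n s)) (b : Fin (n t)) :
    Commute (universalModel n s a) (universalModel n t b) := by
  refine ext_fockBasis fun α => ?_
  simp only [mul_apply_eq_comp, universalModel_fockBasis, prependLetter_comm h]

theorem commute_universalModel_adjoint {s t : Fin k} (h : s ≠ t) (a : Fin (n s)) (b : Fin (n t)) :
    Commute (universalModel n s a) (ContinuousLinearMap.adjoint (universalModel n t b)) := by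
  refine ext_fockBasis fun α => ?_
  simp only [mul_apply_eq_comp, universalModel_fockBasis]
  have hself : ∀ f, ContinuousLinearMap.adjoint (universalModel n t b)
      (universalModel n t b f) = f := fun f =>
    DFunLike.congr_fun (adjoint_universalModel_mul_self t b) f
  by_cases hα : α ∈ Set.range (prependLetter t b)
  · obtain ⟨β, rfl⟩ := hα
    rw [prependLetter_comm h, ← universalModel_fockBasis t b, ← universalModel_fockBasis t b,
      hself, hself, universalModel_fockBasis]
  · rw [adjoint_universalModel_eq_zero hα, adjoint_universalModel_eq_zero, map_zero]
    rw [mem_range_prependLetter] at hα ⊢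
    simpa only [prependLetter, Function.update_of_ne h.symm] using hα

/-- The operator `∑_j S_{i,j} S_{i,j}^*` is an orthogonal projection. -/
theorem norm_sum_universalModel_le_one (i : Fin k) :
    ‖∑ j, universalModel n i j * ContinuousLinearMap.adjoint (universalModel n i j)‖ ≤ 1 := by
  set Q := ∑ j, universalModel n i j * ContinuousLinearMap.adjoint (universalModel n i j) with hQ
  have hsa : star Q = Q :=
    (IsSelfAdjoint.of_nonneg (Finset.sum_nonneg fun j _ => mul_star_self_nonneg _)).star_eq
  have hid : Q * Q = Q := by
    conv_lhs => rw [hQ, Finset.sum_mul_sum]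
    rw [hQ]
    refine Finset.sum_congr rfl fun j _ => ?_
    rw [Finset.sum_eq_single j]
    · rw [mul_assoc, ← mul_assoc (ContinuousLinearMap.adjoint _),
        adjoint_universalModel_mul_self, one_mul]
    · intro l _ hl
      rw [mul_assoc, ← mul_assoc (ContinuousLinearMap.adjoint _),
        adjoint_universalModel_mul_of_ne i hl.symm, zero_mul, mul_zero]
    · simp
  have hn : ‖Q‖ * ‖Q‖ = ‖Q‖ := by
    conv_rhs => rw [← hid]
    conv_rhs => enter [1, 1]; rw [← hsa]
    exact (CStarRing.norm_star_mul_self).symm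
  nlinarith [norm_nonneg Q]

variable {H : Type u} [NormedAddCommGroup H] [InnerProductSpace ℂ H] [CompleteSpace H]

/-- The tuple `r V S V^*`: the multiple `r S` of the universal model, transported by an isometry `V`
to the range of `V` and extended by zero to its orthogonal complement. -/
def modelPoint (V : Fock n →ₗᵢ[ℂ] H) (r : ℝ) : OpTuple n H := fun i j =>
  (r : ℂ) • (V.toContinuousLinearMap.comp ((universalModel n i j).comp
    (ContinuousLinearMap.adjoint V.toContinuousLinearMap)))

theorem adjoint_isometry_apply (V : Fock n →ₗᵢ[ℂ] H) (f : Fock n) :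
    ContinuousLinearMap.adjoint V.toContinuousLinearMap (V f) = f := by
  refine ext_inner_left ℂ fun g => ?_
  rw [ContinuousLinearMap.adjoint_inner_right]
  exact V.inner_map_map g f

theorem modelPoint_apply (V : Fock n →ₗᵢ[ℂ] H) (r : ℝ) (i : Fin k) (j : Fin (n i)) (α : Word n) :
    modelPoint V r i j (V (fockBasis α)) = (r : ℂ) • V (fockBasis (prependLetter i j α)) := by
  simp only [modelPoint, smul_apply, ContinuousLinearMap.comp_apply,
    LinearIsometry.coe_toContinuousLinearMap]
  rw [adjoint_isometry_apply, universalModel_fockBasis]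

theorem adjoint_modelPoint (V : Fock n →ₗᵢ[ℂ] H) (r : ℝ) (i : Fin k) (j : Fin (n i)) :
    ContinuousLinearMap.adjoint (modelPoint V r i j) =
      (r : ℂ) • (V.toContinuousLinearMap.comp
        ((ContinuousLinearMap.adjoint (universalModel n i j)).comp
          (ContinuousLinearMap.adjoint V.toContinuousLinearMap))) := by
  rw [modelPoint, map_smulₛₗ, ContinuousLinearMap.adjoint_comp, ContinuousLinearMap.adjoint_comp,
    ContinuousLinearMap.adjoint_adjoint, ContinuousLinearMap.comp_assoc]
  simp

theorem isometry_conj_mul (V : Fock n →ₗᵢ[ℂ] H) (c : ℂ) (S T : Fock n →L[ℂ] Fock n) :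
    (c • (V.toContinuousLinearMap.comp (S.comp
      (ContinuousLinearMap.adjoint V.toContinuousLinearMap)))) *
    (c • (V.toContinuousLinearMap.comp (T.comp
      (ContinuousLinearMap.adjoint V.toContinuousLinearMap)))) =
    (c * c) • (V.toContinuousLinearMap.comp ((S * T).comp
      (ContinuousLinearMap.adjoint V.toContinuousLinearMap))) := by
  ext f
  simp only [mul_apply_eq_comp, smul_apply, ContinuousLinearMap.comp_apply,
    LinearIsometry.coe_toContinuousLinearMap, map_smul, smul_smul, adjoint_isometry_apply]

theorem modelPoint_mem (V : Fock n →ₗᵢ[ℂ] H) {r : ℝ} (hr0 : 0 ≤ r) (hr1 : r < 1) :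
    modelPoint V r ∈ regularPolyball n H := by
  refine mem_regularPolyball_of_doublyCommuting (fun s t hst a b => ?_) (fun s t hst a b => ?_)
    fun i => ?_
  · rw [Commute, SemiconjBy, modelPoint, modelPoint, isometry_conj_mul, isometry_conj_mul,
      (commute_universalModel hst a b).eq]
  · rw [Commute, SemiconjBy, adjoint_modelPoint, modelPoint, isometry_conj_mul, isometry_conj_mul,
      (commute_universalModel_adjoint hst a b).eq]
  · have h : ∑ j, modelPoint V r i j * ContinuousLinearMap.adjoint (modelPoint V r i j) =
        ((r : ℂ) * r) • (V.toContinuousLinearMap.comp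
          ((∑ j, universalModel n i j * ContinuousLinearMap.adjoint (universalModel n i j)).comp
            (ContinuousLinearMap.adjoint V.toContinuousLinearMap))) := by
      rw [ContinuousLinearMap.finsetSum_comp, ContinuousLinearMap.comp_finsetSum,
        Finset.smul_sum]
      refine Finset.sum_congr rfl fun j _ => ?_
      rw [adjoint_modelPoint, modelPoint, isometry_conj_mul]
    rw [h, norm_smul, norm_mul, Complex.norm_real, Real.norm_of_nonneg hr0]
    have hV : ‖V.toContinuousLinearMap‖ ≤ 1 := V.norm_toContinuousLinearMap_le
    have hV' : ‖ContinuousLinearMap.adjoint V.toContinuousLinearMap‖ ≤ 1 := by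
      rwa [LinearIsometryEquiv.norm_map]
    have hle : ‖V.toContinuousLinearMap.comp
          ((∑ j, universalModel n i j * ContinuousLinearMap.adjoint (universalModel n i j)).comp
            (ContinuousLinearMap.adjoint V.toContinuousLinearMap))‖ ≤ 1 := by
      refine (ContinuousLinearMap.opNorm_comp_le _ _).trans
        (mul_le_one₀ hV (norm_nonneg _) ?_)
      exact (ContinuousLinearMap.opNorm_comp_le _ _).trans
        (mul_le_one₀ (norm_sum_universalModel_le_one i) (norm_nonneg _) hV')
    nlinarith [norm_nonneg (V.toContinuousLinearMap.comp
          ((∑ j, universalModel n i j * ContinuousLinearMap.adjoint (universalModel n i j)).comp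
            (ContinuousLinearMap.adjoint V.toContinuousLinearMap)))]

theorem exists_isometry_fock (hH : ¬ FiniteDimensional ℂ H) : Nonempty (Fock n →ₗᵢ[ℂ] H) := by
  obtain ⟨w, b, hb⟩ := exists_hilbertBasis ℂ H
  have hw : Infinite w := by
    rw [← not_finite_iff_infinite]
    intro hfin
    have := Fintype.ofFinite w
    refine hH ?_
    exact b.toOrthonormalBasis.toBasis.finiteDimensional_of_finite
  have hc : Countable (Word n) := by
    have : ∀ i, Countable (FreeMonoid (Fin (n i))) := fun i =>
      inferInstanceAs (Countable (List (Fin (n i))))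
    infer_instance
  obtain ⟨f, hf⟩ := exists_injective_nat (Word n)
  have ho : Orthonormal ℂ fun α : Word n => b (Infinite.natEmbedding w (f α)) :=
    b.orthonormal.comp _ ((Infinite.natEmbedding w).injective.comp hf)
  exact ⟨ho.orthogonalFamily.linearIsometry⟩

end Model


/-! ### Matrix entries of a free holomorphic function at the model points -/

section Entries

variable {k : ℕ} {n : Fin k → ℕ}
variable {H : Type u} [NormedAddCommGroup H] [InnerProductSpace ℂ H]
variable {K : Type v} [NormedAddCommGroup K] [InnerProductSpace ℂ K]
variable {A : Word n → (K →L[ℂ] K)} {X : OpTuple n H} {e : Word n → H} {c : ℂ}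

/-- The matrix entries of `F(X)` at a tuple that acts like `c S` on the family `e`. -/
theorem hasSum_inner_freeEval (hX : ∀ i j α, X i j (e α) = c • e (prependLetter i j α))
    (hs : Summable (seriesTerm A X)) (x y : K) (γ ω : Word n) :
    HasSum (fun p => ∑ α ∈ multiDegree n p,
        c ^ totalLength α * inner ℂ y (A α x) * inner ℂ (e γ) (e (α * ω)))
      (inner ℂ (pureTensor y (e γ)) (freeEval A X (pureTensor x (e ω)))) := by
  have h := ((hs.hasSum).mapL (ContinuousLinearMap.apply ℂ _ (pureTensor x (e ω)))).mapL
    (innerSL ℂ (pureTensor y (e γ)))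
  refine h.congr_fun fun p => ?_
  simp only [ContinuousLinearMap.apply_apply, innerSL_apply_apply, seriesTerm, sum_apply,
    inner_sum, opTensor_pureTensor, monomial_apply_of_creation hX, inner_pureTensor,
    inner_smul_right]
  exact Finset.sum_congr rfl fun α _ => by ring

theorem inner_freeEval_of_eq_mul (he : Orthonormal ℂ e)
    (hX : ∀ i j α, X i j (e α) = c • e (prependLetter i j α))
    (hs : Summable (seriesTerm A X)) (x y : K) (α ω : Word n) :
    inner ℂ (pureTensor y (e (α * ω))) (freeEval A X (pureTensor x (e ω))) =
      c ^ totalLength α * inner ℂ y (A α x) := by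
  have hcancel : ∀ β : Word n, β ≠ α → inner ℂ (e (α * ω)) (e (β * ω)) = (0 : ℂ) := fun β hβ =>
    he.2 fun h => hβ (funext fun i => (mul_right_cancel (congrFun h i)).symm)
  refine (hasSum_inner_freeEval hX hs x y (α * ω) ω).unique ?_
  -- only the multidegree of `α` contributes, and in it only the word `α`
  have := hasSum_single (f := fun p => ∑ β ∈ multiDegree n p,
    c ^ totalLength β * inner ℂ y (A β x) * inner ℂ (e (α * ω)) (e (β * ω)))
    (fun i => (α i).length) fun p hp => by
      refine Finset.sum_eq_zero fun β hβ => ?_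
      rw [hcancel β, mul_zero]
      rintro rfl
      exact hp (funext fun i => ((mem_multiDegree p β).1 hβ i).symm)
  convert this using 1
  rw [Finset.sum_eq_single α]
  · rw [inner_self_eq_norm_sq_to_K, he.1]; simp
  · intro β _ hβ
    rw [hcancel β hβ, mul_zero]
  · intro h
    exact absurd ((mem_multiDegree _ α).2 fun i => rfl) h

theorem inner_freeEval_of_not_rightLE (he : Orthonormal ℂ e)
    (hX : ∀ i j α, X i j (e α) = c • e (prependLetter i j α))
    (hs : Summable (seriesTerm A X)) (x y : K) {γ ω : Word n} (h : ¬ RightLE ω γ) :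
    inner ℂ (pureTensor y (e γ)) (freeEval A X (pureTensor x (e ω))) = 0 := by
  refine (hasSum_inner_freeEval hX hs x y γ ω).unique ?_
  convert hasSum_zero using 2 with p
  refine Finset.sum_eq_zero fun α _ => ?_
  rw [he.2, mul_zero]
  exact fun e => h (rightLE_iff.2 ⟨α, e⟩)

end Entries

/-! ### The finite Landau inequality -/

section Landau

variable {k : ℕ} {n : Fin k → ℕ}
variable {K : Type v} [NormedAddCommGroup K] [InnerProductSpace ℂ K]

/-- The Landau inequality for finitely many coefficients, obtained from the positivity of the finite
sections by testing on vectors of the form `y_α = t A_α x`. -/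
theorem sum_norm_sq_coeff_le {ι : Type*} {A : ι → (K →L[ℂ] K)} {D : K →L[ℂ] K} (J : Finset ι)
    (hpos : ∀ (x : K) (y : ι → K), 0 ≤ RCLike.re (inner ℂ x (D x)) +
      ∑ α ∈ J, RCLike.re (inner ℂ (y α) (D (y α))) - ∑ α ∈ J, RCLike.re (inner ℂ (y α) (A α x)))
    (x : K) : ∑ α ∈ J, ‖A α x‖ ^ 2 ≤ 4 * ‖D‖ * RCLike.re (inner ℂ x (D x)) := by
  set σ := ∑ α ∈ J, ‖A α x‖ ^ 2 with hσ
  set d := RCLike.re (inner ℂ x (D x)) with hd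
  have hσ0 : 0 ≤ σ := Finset.sum_nonneg fun _ _ => sq_nonneg _
  have key : ∀ t : ℝ, t * σ ≤ d + t ^ 2 * (‖D‖ * σ) := by
    intro t
    have h := hpos x fun α => (t : ℂ) • A α x
    have h1 : ∑ α ∈ J, RCLike.re (inner ℂ ((t : ℂ) • A α x) (A α x)) = t * σ := by
      rw [hσ, Finset.mul_sum]
      refine Finset.sum_congr rfl fun α _ => ?_
      rw [inner_smul_left, Complex.conj_ofReal, ← inner_self_eq_norm_sq (𝕜 := ℂ)]
      exact Complex.re_ofReal_mul _ _
    have h2 : ∑ α ∈ J, RCLike.re (inner ℂ ((t : ℂ) • A α x) (D ((t : ℂ) • A α x))) ≤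
        t ^ 2 * (‖D‖ * σ) := by
      rw [hσ, Finset.mul_sum, Finset.mul_sum]
      refine Finset.sum_le_sum fun α _ => (re_inner_apply_le D _).trans (le_of_eq ?_)
      rw [norm_smul, Complex.norm_real, mul_pow, Real.norm_eq_abs, sq_abs]
      ring
    rw [h1] at h
    linarith
  by_cases hD : ‖D‖ = 0
  · have hd0 : d = 0 := by
      rw [norm_eq_zero] at hD
      simp [hd, hD]
    have := key 1
    rw [hD] at this ⊢
    linarith
  · have hpos : 0 < ‖D‖ := lt_of_le_of_ne (norm_nonneg _) (Ne.symm hD)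
    -- this `t` minimises the right-hand side minus the left-hand side of `key`
    have := key (1 / (2 * ‖D‖))
    field_simp at this
    nlinarith

variable {A : Word n → (K →L[ℂ] K)}
variable {H : Type u} [NormedAddCommGroup H] [InnerProductSpace ℂ H] [CompleteSpace H]

theorem re_inner_le_of_realPart_le_one {F : H →L[ℂ] H} (h : (realPart F : H →L[ℂ] H) ≤ 1)
    (f : H) : RCLike.re (inner ℂ f (F f)) ≤ ‖f‖ ^ 2 := by
  have h1 := ((ContinuousLinearMap.le_def _ _).1 h).re_inner_nonneg_right f
  have h2 : RCLike.re (inner ℂ f ((realPart F : H →L[ℂ] H) f)) = RCLike.re (inner ℂ f (F f)) := by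
    rw [realPart_apply_coe, ContinuousLinearMap.star_eq_adjoint, smul_apply, add_apply,
      ← Complex.coe_smul, inner_smul_right, inner_add_right,
      ContinuousLinearMap.adjoint_inner_right, ← inner_conj_symm (F f) f]
    simp only [RCLike.mul_re, map_add, RCLike.conj_re]
    simp
    ring
  rw [sub_apply, inner_sub_right, map_sub, h2] at h1
  rw [one_apply_eq_self, inner_self_eq_norm_sq] at h1
  linarith

/-- The constant coefficient is positive, since `F(0) = A₀ ⊗ 1`. The zero tuple is treated as the
model point with `r = 0`. -/
theorem coeff_one_isPositive (hF : IsFreeHolomorphic.{u} A) (V : Fock n →ₗᵢ[ℂ] H)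
    (hF0 : 0 ≤ freeEval A (0 : OpTuple n H)) : (A 1).IsPositive := by
  have h0 : (0 : OpTuple n H) = modelPoint V 0 := by
    funext i j
    simp [modelPoint]
  have he : Orthonormal ℂ fun α => V (fockBasis (n := n) α) :=
    orthonormal_fockBasis.comp_linearIsometry V
  rw [ContinuousLinearMap.nonneg_iff_isPositive] at hF0
  rw [ContinuousLinearMap.isPositive_iff_complex]
  intro x
  have h1 := inner_freeEval_of_eq_mul (A := A) he (modelPoint_apply V 0)
    (hF H _ (modelPoint_mem V le_rfl one_pos)) x x 1 1
  rw [← h0] at h1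
  have h2 := hF0.inner_nonneg_right (pureTensor x (V (fockBasis ((1 : Word n) * 1))))
  rw [mul_one] at h1 h2
  rw [h1] at h2
  have h3 : totalLength (1 : Word n) = 0 := by
    simp [totalLength]
  rw [h3, pow_zero, one_mul] at h2
  rw [← inner_conj_symm, Complex.conj_eq_iff_im.2 (Complex.nonneg_iff.1 h2).2.symm]
  exact ⟨Complex.conj_eq_iff_re.1 (Complex.conj_eq_iff_im.2 (Complex.nonneg_iff.1 h2).2.symm),
    (Complex.nonneg_iff.1 h2).1⟩

/-- Positivity of the finite sections of the Landau matrix. The sign of `x` is chosen so that the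
column of the coefficients enters with a minus, as it does in `1 - F`. -/
theorem landau_finite (hF : IsFreeHolomorphic.{u} A) (V : Fock n →ₗᵢ[ℂ] H)
    (hRe : ∀ X ∈ regularPolyball n H,
      (realPart (freeEval A X) : HilbertTensor K H →L[ℂ] HilbertTensor K H) ≤ 1)
    {Λ : Set (Word n)} (hΛ : IsRightMinimal Λ) (hΛ1 : (1 : Word n) ∉ Λ)
    (J : Finset (Word n)) (hJ : ∀ α ∈ J, α ∈ Λ) (x : K) (y : Word n → K) :
    0 ≤ RCLike.re (inner ℂ x ((1 - A 1) x)) + ∑ α ∈ J, RCLike.re (inner ℂ (y α) ((1 - A 1) (y α)))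
      - ∑ α ∈ J, RCLike.re (inner ℂ (y α) (A α x)) := by
  classical
  have he : Orthonormal ℂ fun α => V (fockBasis (n := n) α) :=
    orthonormal_fockBasis.comp_linearIsometry V
  have h1J : (1 : Word n) ∉ J := fun h => hΛ1 (hJ _ h)
  -- the inequality at the point `r S`, tested on `x ⊗ e₁ + ∑ y_α ⊗ e_α`
  have hr : ∀ r : ℝ, 0 ≤ r → r < 1 →
      ∑ α ∈ J, r ^ totalLength α * RCLike.re (inner ℂ (y α) (A α x)) ≤
      RCLike.re (inner ℂ x ((1 - A 1) x)) +
        ∑ α ∈ J, RCLike.re (inner ℂ (y α) ((1 - A 1) (y α))) := by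
    intro r hr0 hr1
    have hmem := modelPoint_mem V hr0 hr1
    have hs := hF H _ hmem
    have hX := modelPoint_apply V r
    set F := freeEval A (modelPoint V r) with hFdef
    set z : Word n → K := fun α => if α = 1 then x else y α with hz
    have hz1 : z 1 = x := if_pos rfl
    have hzJ : ∀ α ∈ J, z α = y α := fun α hα => if_neg fun h => by subst h; exact h1J hα
    set f : Word n → HilbertTensor K H := fun α => pureTensor (z α) (V (fockBasis α)) with hf
    have hdiag : ∀ α, inner ℂ (f α) (F (f α)) = inner ℂ (z α) (A 1 (z α)) := by
      intro α
      have := inner_freeEval_of_eq_mul (A := A) he hX hs (z α) (z α) 1 α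
      rw [one_mul] at this
      rw [this]
      simp [totalLength]
    have hcol : ∀ α, inner ℂ (f α) (F (f 1)) = (r : ℂ) ^ totalLength α * inner ℂ (z α) (A α x) := by
      intro α
      have := inner_freeEval_of_eq_mul (A := A) he hX hs (z 1) (z α) α 1
      rw [mul_one] at this
      rw [this, hz1]
    have hrow : ∀ α ∈ J, inner ℂ (f 1) (F (f α)) = 0 := by
      intro α hα
      refine inner_freeEval_of_not_rightLE he hX hs _ _ fun h => ?_
      refine h1J ?_
      convert hα
      funext i
      obtain ⟨σ, hσ⟩ := h i
      have := congrArg FreeMonoid.length hσ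
      rw [FreeMonoid.length_mul, Pi.one_apply, FreeMonoid.length_one] at this
      exact (FreeMonoid.length_eq_zero.1 (by omega)).symm
    have hoff : ∀ α ∈ J, ∀ β ∈ J, β ≠ α → inner ℂ (f α) (F (f β)) = 0 := by
      intro α hα β hβ hne
      exact inner_freeEval_of_not_rightLE he hX hs _ _ fun h =>
        hne (hΛ β (hJ β hβ) α (hJ α hα) h)
    have hmain := re_inner_le_of_realPart_le_one (hRe _ hmem) (∑ α ∈ insert 1 J, f α)
    have hnorm : ‖∑ α ∈ insert 1 J, f α‖ ^ 2 = ∑ α ∈ insert 1 J, ‖z α‖ ^ 2 := by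
      rw [← inner_self_eq_norm_sq (𝕜 := ℂ), sum_inner, map_sum]
      refine Finset.sum_congr rfl fun α hα => ?_
      rw [inner_sum, Finset.sum_eq_single α]
      · rw [inner_self_eq_norm_sq, hf, norm_pureTensor, he.1, mul_one]
      · intro β _ hβ
        rw [hf, inner_pureTensor, he.2 hβ.symm, mul_zero]
      · exact fun h => absurd hα h
    have hquad : inner ℂ (∑ α ∈ insert 1 J, f α) (F (∑ α ∈ insert 1 J, f α)) =
        inner ℂ x (A 1 x) + ∑ α ∈ J, ((r : ℂ) ^ totalLength α * inner ℂ (y α) (A α x) +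
          inner ℂ (y α) (A 1 (y α))) := by
      rw [map_sum, sum_inner, Finset.sum_insert h1J]
      congr 1
      · rw [inner_sum, Finset.sum_insert h1J, hdiag, hz1, Finset.sum_eq_zero hrow, add_zero]
      · refine Finset.sum_congr rfl fun α hα => ?_
        rw [inner_sum, Finset.sum_insert h1J, hcol, Finset.sum_eq_single α (hoff α hα)
          (fun h => absurd hα h), hdiag, hzJ α hα]
    rw [← hFdef, hquad, hnorm, Finset.sum_insert h1J, hz1,
      Finset.sum_congr (s₁ := J) rfl fun α hα => show ‖z α‖ ^ 2 = ‖y α‖ ^ 2 by rw [hzJ α hα],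
      map_add, map_sum] at hmain
    have hD : ∀ u : K, RCLike.re (inner ℂ u ((1 - A 1) u)) =
        ‖u‖ ^ 2 - RCLike.re (inner ℂ u (A 1 u)) := by
      intro u
      rw [sub_apply, inner_sub_right, map_sub, one_apply_eq_self, inner_self_eq_norm_sq]
    have hre : ∀ α, RCLike.re ((r : ℂ) ^ totalLength α * inner ℂ (y α) (A α x)) =
        r ^ totalLength α * RCLike.re (inner ℂ (y α) (A α x)) := by
      intro α
      rw [← Complex.ofReal_pow]
      exact Complex.re_ofReal_mul _ _
    simp only [map_add, hre, Finset.sum_add_distrib] at hmain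
    simp only [hD, Finset.sum_sub_distrib]
    linarith
  have hlim : Filter.Tendsto
      (fun r : ℝ => ∑ α ∈ J, r ^ totalLength α * RCLike.re (inner ℂ (y α) (A α x)))
      (nhdsWithin 1 (Set.Iio 1)) (nhds (∑ α ∈ J, RCLike.re (inner ℂ (y α) (A α x)))) := by
    have hc : Continuous fun r : ℝ =>
        ∑ α ∈ J, r ^ totalLength α * RCLike.re (inner ℂ (y α) (A α x)) := by fun_prop
    have := hc.tendsto 1
    simp only [one_pow, one_mul] at this
    exact this.mono_left nhdsWithin_le_nhds
  rw [sub_nonneg]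
  refine le_of_tendsto hlim ?_
  filter_upwards [Ioo_mem_nhdsLT (zero_lt_one' ℝ)] with r hr'
  exact hr r hr'.1.le hr'.2

end Landau


/-! ### Column operators and the Landau matrix -/

section Matrix

theorem sum_norm_sq_lp_le {ι : Type*} {K : Type v} [NormedAddCommGroup K]
    (f : lp (fun _ : ι => K) 2) (s : Finset ι) :
    ∑ i ∈ s, ‖f i‖ ^ 2 ≤ ‖f‖ ^ 2 := by
  have := lp.sum_rpow_le_norm_rpow (p := 2) (by norm_num) f s
  simpa using this

variable {ι : Type*} {E : Type*} [NormedAddCommGroup E] [InnerProductSpace ℂ E]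
variable {K : Type v} [NormedAddCommGroup K] [InnerProductSpace ℂ K] [CompleteSpace K]

/-- A square-summable column of operators defines an operator into the Hilbert direct sum. -/
theorem exists_column (c : ι → (E →L[ℂ] K)) {M : ℝ} (hM : 0 ≤ M)
    (hc : ∀ (s : Finset ι) x, ∑ i ∈ s, ‖c i x‖ ^ 2 ≤ M ^ 2 * ‖x‖ ^ 2) :
    ∃ C : E →L[ℂ] lp (fun _ : ι => K) 2, ∀ x i, C x i = c i x := by
  classical
  obtain ⟨C, hC, -⟩ := exists_hasStrongSum_of_orthogonal
    (fun i => (lp.singleContinuousLinearMap ℂ (fun _ : ι => K) 2 i).comp (c i)) hM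
    (fun i j hij x => by
      simp only [ContinuousLinearMap.comp_apply, lp.singleContinuousLinearMap_apply]
      rw [lp.inner_single_left, lp.coeFn_single, Pi.single_eq_of_ne hij, inner_zero_right])
    (fun s x => by
      simp only [ContinuousLinearMap.comp_apply, lp.singleContinuousLinearMap_apply]
      simpa only [lp.norm_single (zero_lt_two)] using hc s x)
  refine ⟨C, fun x i => ?_⟩
  have h := (hC x).mapL (lp.evalCLM ℂ (fun _ : ι => K) 2 i)
  refine h.unique ?_
  convert hasSum_single (f := fun j => lp.evalCLM ℂ (fun _ : ι => K) 2 i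
    (((lp.singleContinuousLinearMap ℂ (fun _ : ι => K) 2 j).comp (c j)) x)) i ?_ using 1
  · change c i x = lp.single (E := fun _ : ι => K) 2 i (c i x) i
    rw [lp.coeFn_single, Pi.single_eq_same]
  · intro j hj
    change lp.single (E := fun _ : ι => K) 2 j (c j x) i = 0
    rw [lp.coeFn_single, Pi.single_eq_of_ne hj.symm]

/-- The operator that acts as `D` in every coordinate. -/
theorem exists_diagonal (ι : Type*) (D : K →L[ℂ] K) :
    ∃ T : lp (fun _ : ι => K) 2 →L[ℂ] lp (fun _ : ι => K) 2, ∀ f i, T f i = D (f i) := by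
  obtain ⟨T, hT⟩ := exists_column
    (fun i => D.comp (lp.evalCLM ℂ (fun _ : ι => K) 2 i)) (norm_nonneg D) fun s f => by
      calc ∑ i ∈ s, ‖D (f i)‖ ^ 2 ≤ ∑ i ∈ s, ‖D‖ ^ 2 * ‖f i‖ ^ 2 := by
            refine Finset.sum_le_sum fun i _ => ?_
            rw [← mul_pow]
            gcongr
            exact D.le_opNorm _
        _ ≤ ‖D‖ ^ 2 * ‖f‖ ^ 2 := by
            rw [← Finset.mul_sum]
            gcongr
            exact sum_norm_sq_lp_le f s
  exact ⟨T, hT⟩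

variable [CompleteSpace E]

theorem adjoint_column_single [DecidableEq ι] {c : ι → (E →L[ℂ] K)}
    {C : E →L[ℂ] lp (fun _ : ι => K) 2}
    (hC : ∀ x i, C x i = c i x) (i : ι) (y : K) :
    ContinuousLinearMap.adjoint C (lp.single 2 i y) = ContinuousLinearMap.adjoint (c i) y := by
  refine ext_inner_left ℂ fun x => ?_
  rw [ContinuousLinearMap.adjoint_inner_right, ContinuousLinearMap.adjoint_inner_right,
    lp.inner_single_right, hC]

/-- The strong operator sum of `c_i^* c_i` over a square-summable column. -/
theorem exists_hasStrongSum_adjoint_mul (c : ι → (E →L[ℂ] E)) {M : ℝ} (hM : 0 ≤ M)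
    (hc : ∀ (s : Finset ι) x, ∑ i ∈ s, ‖c i x‖ ^ 2 ≤ M ^ 2 * ‖x‖ ^ 2) :
    ∃ B : E →L[ℂ] E, HasStrongSum (fun i => ContinuousLinearMap.adjoint (c i) * c i) B ∧
      IsSelfAdjoint B := by
  classical
  obtain ⟨C, hC⟩ := exists_column c hM hc
  refine ⟨(ContinuousLinearMap.adjoint C).comp C, fun x => ?_,
    ((ContinuousLinearMap.isPositive_adjoint_comp_self C).isSelfAdjoint)⟩
  have h := (lp.hasSum_single (p := 2) ENNReal.ofNat_ne_top (C x)).mapL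
    (ContinuousLinearMap.adjoint C)
  refine h.congr_fun fun i => ?_
  rw [adjoint_column_single hC, hC]
  rfl

end Matrix

section Landau

variable {k : ℕ} {n : Fin k → ℕ}
variable {K : Type v} [NormedAddCommGroup K] [InnerProductSpace ℂ K] [CompleteSpace K]
variable {A : Word n → (K →L[ℂ] K)} {Λ : Set (Word n)}

/-- The Landau matrix is `2 (diag(D) + Re(C ∘ ev))` with the column `C` of the coefficients
and `D = 1 - A₀`; its positivity is that of the finite sections. -/
theorem exists_landauMatrix_nonneg (hD : IsSelfAdjoint (1 - A 1)) {M : ℝ} (hM : 0 ≤ M)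
    (hcol : ∀ (s : Finset Λ) x, ∑ α ∈ s, ‖A α x‖ ^ 2 ≤ M ^ 2 * ‖x‖ ^ 2)
    (hpos : ∀ (s : Finset Λ) (x : K) (y : Λ → K), 0 ≤ RCLike.re (inner ℂ x ((1 - A 1) x)) +
      ∑ α ∈ s, RCLike.re (inner ℂ (y α) ((1 - A 1) (y α)))
      - ∑ α ∈ s, RCLike.re (inner ℂ (y α) (A α x))) :
    ∃ P : lp (fun _ : Option Λ => K) 2 →L[ℂ] lp (fun _ : Option Λ => K) 2,
      HasOperatorMatrix P (landauMatrix A Λ) ∧ 0 ≤ P := by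
  -- the decidability instance that `HasOperatorMatrix` uses
  let : DecidableEq (Option Λ) := fun a b => Classical.propDecidable (a = b)
  set c : Option Λ → (K →L[ℂ] K) := fun i => i.elim 0 fun α => A α with hc
  obtain ⟨C, hC⟩ := exists_column c hM fun s x => by
    refine le_trans ?_ (hcol s.eraseNone x)
    refine (Finset.sum_le_sum_of_subset_of_nonneg (t := s.eraseNone.insertNone)
      (fun i hi => ?_) fun _ _ _ => sq_nonneg _).trans (le_of_eq ?_)
    · rw [Finset.mem_insertNone]
      rintro a rfl
      exact Finset.mem_eraseNone.2 hi
    · rw [Finset.sum_insertNone]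
      simp [hc]
  obtain ⟨Δ, hΔ⟩ := exists_diagonal (Option Λ) (1 - A 1)
  set ev := lp.evalCLM ℂ (fun _ : Option Λ => K) 2 none with hev
  have hev' : ∀ f, ev f = f none := fun f => rfl
  have hevadj : ∀ x, ContinuousLinearMap.adjoint ev x = lp.single 2 none x := by
    intro x
    refine ext_inner_left ℂ fun f => ?_
    rw [ContinuousLinearMap.adjoint_inner_right, lp.inner_single_right]
    rfl
  have hDsa : ∀ x y, inner ℂ ((1 - A 1) x) y = inner ℂ x ((1 - A 1) y) := by
    intro x y
    rw [← ContinuousLinearMap.adjoint_inner_right, ← ContinuousLinearMap.star_eq_adjoint,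
      hD.star_eq]
  have hΔsa : ContinuousLinearMap.adjoint Δ = Δ := by
    refine ContinuousLinearMap.ext fun f => ext_inner_right ℂ fun g => ?_
    rw [ContinuousLinearMap.adjoint_inner_left]
    refine (lp.hasSum_inner f (Δ g)).unique ?_
    refine (lp.hasSum_inner (Δ f) g).congr_fun fun i => ?_
    rw [hΔ, hΔ, hDsa]
  set R := C.comp ev with hR
  refine ⟨(2 : ℂ) • Δ + (R + ContinuousLinearMap.adjoint R), ?_, ?_⟩
  · intro i j x
    have h1 : ContinuousLinearMap.adjoint R (lp.single 2 j x) =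
        lp.single 2 none (ContinuousLinearMap.adjoint (c j) x) := by
      rw [hR, ContinuousLinearMap.adjoint_comp, ContinuousLinearMap.comp_apply,
        adjoint_column_single hC, hevadj]
    simp only [add_apply, smul_apply, h1]
    rw [lp.coeFn_add, lp.coeFn_add, lp.coeFn_smul, Pi.add_apply, Pi.add_apply, Pi.smul_apply, hΔ,
      hR, ContinuousLinearMap.comp_apply, hC, hev']
    simp only [lp.coeFn_single]
    match i, j with
    | none, none => simp [landauMatrix, hc]
    | none, some β => simp [landauMatrix, hc]
    | some α, none => simp [landauMatrix, hc]
    | some α, some β =>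
      by_cases h : α = β
      · subst h; simp [landauMatrix, hc]
      · simp [landauMatrix, hc, h]
  · rw [ContinuousLinearMap.nonneg_iff_isPositive, ContinuousLinearMap.isPositive_def']
    refine ⟨?_, fun f => ?_⟩
    · refine (IsSelfAdjoint.smul ?_ ?_).add (IsSelfAdjoint.add_star_self R)
      · simp
      · exact hΔsa
    · rw [ContinuousLinearMap.reApplyInnerSelf_apply]
      have h1 : RCLike.re (inner ℂ (((2 : ℂ) • Δ + (R + ContinuousLinearMap.adjoint R)) f) f) =
          2 * (RCLike.re (inner ℂ f (Δ f)) + RCLike.re (inner ℂ f (R f))) := by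
        rw [add_apply, add_apply, smul_apply, inner_add_left, inner_add_left,
          ContinuousLinearMap.adjoint_inner_left, inner_smul_left,
          ← ContinuousLinearMap.adjoint_inner_right, hΔsa, map_add, map_add, inner_re_symm (R f) f]
        simp
        ring
      have h2 : HasSum (fun i => RCLike.re (inner ℂ (f i) ((1 - A 1) (f i))) +
          RCLike.re (inner ℂ (f i) (c i (f none))))
          (RCLike.re (inner ℂ f (Δ f)) + RCLike.re (inner ℂ f (R f))) := by
        refine ((RCLike.hasSum_re ℂ (lp.hasSum_inner f (Δ f))).add
          (RCLike.hasSum_re ℂ (lp.hasSum_inner f (R f)))).congr_fun fun i => ?_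
        rw [hΔ, hR, ContinuousLinearMap.comp_apply, hC, hev']
      rw [h1]
      refine mul_nonneg zero_le_two (ge_of_tendsto h2 ?_)
      -- the partial sums over finite sets containing `none` are finite sections
      filter_upwards [Filter.eventually_ge_atTop {none}] with s hs
      have hs' : s = s.eraseNone.insertNone := by
        ext i
        rw [Finset.mem_insertNone]
        match i with
        | none => simpa using hs
        | some a => simp
      rw [hs', Finset.sum_insertNone]
      have h3 := hpos s.eraseNone (-f none) fun α => f (some α)
      simp only [map_neg, inner_neg_left, inner_neg_right, neg_neg, Finset.sum_neg_distrib,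
        sub_neg_eq_add] at h3
      simp only [hc, Option.elim, zero_apply, inner_zero_right, map_zero, add_zero,
        Finset.sum_add_distrib]
      linarith

end Landau


/-! ### Series over orthogonal sets of words -/

section SumCriteria

variable {ι : Type*} {E : Type*} [NormedAddCommGroup E] [InnerProductSpace ℂ E]
  {f : ι → (E →L[ℂ] E)}

theorem summable_of_vanishing_opNorm [CompleteSpace E]
    (h : ∀ ε > 0, ∃ s : Finset ι, ∀ t, Disjoint t s → ‖∑ i ∈ t, f i‖ < ε) : Summable f :=
  summable_iff_vanishing_norm.2 h

theorem opNorm_tsum_le {M : ℝ} (hf : Summable f) (h : ∀ s : Finset ι, ‖∑ i ∈ s, f i‖ ≤ M) :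
    ‖∑' i, f i‖ ≤ M :=
  le_of_tendsto hf.hasSum.norm (Filter.Eventually.of_forall h)

end SumCriteria

section Orthogonal

variable {k : ℕ} {n : Fin k → ℕ}
variable {K : Type v} [NormedAddCommGroup K] [InnerProductSpace ℂ K]
variable {A : Word n → (K →L[ℂ] K)} {Λ : Set (Word n)}

/-- Testing the series on `x ⊗ e₁` recovers the coefficients: at tuples that act like `r S` on an
orthonormal family, its norm dominates that of the column `[r^{|α|} A_α]`. -/
theorem sum_norm_sq_coeff_le_of_hasStrongSum {H : Type u} [NormedAddCommGroup H]
    [InnerProductSpace ℂ H] {X : OpTuple n H} {e : Word n → H} (he : Orthonormal ℂ e) {r : ℝ}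
    (hX : ∀ i j α, X i j (e α) = (r : ℂ) • e (prependLetter i j α))
    {T : HilbertTensor K H →L[ℂ] HilbertTensor K H}
    (hT : HasStrongSum (fun α : Λ => opTensor (A α) (monomial X α)) T) (s : Finset Λ) (x : K) :
    ∑ α ∈ s, (r ^ totalLength (α : Word n)) ^ 2 * ‖A α x‖ ^ 2 ≤ ‖T‖ ^ 2 * ‖x‖ ^ 2 := by
  classical
  set u : Λ → HilbertTensor K H := fun α =>
    pureTensor (A α x) ((r : ℂ) ^ totalLength (α : Word n) • e α) with hu
  have hterm : ∀ α : Λ, opTensor (A α) (monomial X α) (pureTensor x (e 1)) = u α := by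
    intro α
    rw [opTensor_pureTensor, monomial_apply_of_creation hX, mul_one]
  have hsum : HasSum u (T (pureTensor x (e 1))) :=
    (hT (pureTensor x (e 1))).congr_fun fun α => (hterm α).symm
  have horth : ∀ α β : Λ, α ≠ β → inner ℂ (u α) (u β) = 0 := by
    intro α β h
    rw [hu, inner_pureTensor, inner_smul_left, inner_smul_right,
      he.2 fun h' => h (Subtype.ext h')]
    simp
  have hnorm : ∀ α, ‖u α‖ ^ 2 = (r ^ totalLength (α : Word n)) ^ 2 * ‖A α x‖ ^ 2 := by
    intro α
    rw [hu, norm_pureTensor, norm_smul, he.1, ← Complex.ofReal_pow, Complex.norm_real, mul_one,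
      mul_pow, Real.norm_eq_abs, sq_abs, mul_comm]
  simp only [← hnorm]
  set σ := ∑ α ∈ s, ‖u α‖ ^ 2 with hσ
  have hpart : ∀ t : Finset Λ, s ⊆ t → RCLike.re (inner ℂ (∑ α ∈ s, u α) (∑ α ∈ t, u α)) = σ := by
    intro t hst
    rw [sum_inner, map_sum]
    refine Finset.sum_congr rfl fun α hα => ?_
    rw [inner_sum, Finset.sum_eq_single α (fun β _ hβ => horth α β hβ.symm)
      (fun h => absurd (hst hα) h), inner_self_eq_norm_sq]
  have hself : ‖∑ α ∈ s, u α‖ ^ 2 = σ := by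
    rw [← inner_self_eq_norm_sq (𝕜 := ℂ), hpart s subset_rfl]
  have hlim : RCLike.re (inner ℂ (∑ α ∈ s, u α) (T (pureTensor x (e 1)))) = σ := by
    have hc : Continuous fun f : HilbertTensor K H => RCLike.re (inner ℂ (∑ α ∈ s, u α) f) := by
      fun_prop
    refine tendsto_nhds_unique ((hc.tendsto _).comp hsum) (tendsto_const_nhds.congr' ?_)
    filter_upwards [Filter.eventually_ge_atTop s] with t ht
    exact (hpart t ht).symm
  have hle : ‖∑ α ∈ s, u α‖ ^ 2 ≤ ‖∑ α ∈ s, u α‖ * (‖T‖ * ‖x‖) := by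
    calc ‖∑ α ∈ s, u α‖ ^ 2 = RCLike.re (inner ℂ (∑ α ∈ s, u α) (T (pureTensor x (e 1)))) := by
          rw [hself, hlim]
      _ ≤ ‖∑ α ∈ s, u α‖ * ‖T (pureTensor x (e 1))‖ := re_inner_le_norm _ _
      _ ≤ ‖∑ α ∈ s, u α‖ * (‖T‖ * ‖pureTensor x (e 1)‖) := by
          gcongr
          exact T.le_opNorm _
      _ = _ := by rw [norm_pureTensor, he.1, mul_one]
  rw [← hself, ← mul_pow]
  have h0 : 0 ≤ ‖T‖ * ‖x‖ := by positivity
  nlinarith [norm_nonneg (∑ α ∈ s, u α), sq_nonneg (‖∑ α ∈ s, u α‖ - ‖T‖ * ‖x‖)]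

variable [CompleteSpace K]

/-- For orthogonal `Λ` the operators `A_α ⊗ S_α` have pairwise orthogonal ranges, so the series
converges strongly as soon as the column `[A_α]` is bounded, with the same bound. -/
theorem exists_hasStrongSum_universalModel (hΛ : IsOrthogonalSet Λ) {M : ℝ} (hM : 0 ≤ M)
    (hcol : ∀ (s : Finset Λ) x, ∑ α ∈ s, ‖A α x‖ ^ 2 ≤ M ^ 2 * ‖x‖ ^ 2) :
    ∃ T : HilbertTensor K (Fock n) →L[ℂ] HilbertTensor K (Fock n),
      HasStrongSum (fun α : Λ => opTensor (A α) (monomial (universalModel n) α)) T ∧ ‖T‖ ≤ M := by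
  refine exists_hasStrongSum_of_orthogonal _ hM (fun α β hne f => ?_) fun s f => ?_
  · rw [← ContinuousLinearMap.adjoint_inner_right, adjoint_opTensor, ← mul_apply_eq_comp,
      ← opTensor_mul, hΛ β β.2 α α.2 fun h => hne (Subtype.ext h.symm), opTensor_zero_right,
      zero_apply, inner_zero_right]
  · refine le_trans (Finset.sum_le_sum fun α _ => ?_)
      (sum_norm_sq_opTensor_one_le s (fun α : Λ => A α) hM (hcol s) f)
    have hfac : opTensor (A α) (monomial (universalModel n) α) =
        opTensor 1 (monomial (universalModel n) α) * opTensor (A α) 1 := by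
      rw [← opTensor_mul, one_mul, mul_one]
    have hle : ‖opTensor (1 : K →L[ℂ] K) (monomial (universalModel n) α)‖ ≤ 1 :=
      (norm_opTensor_le _ _).trans (mul_le_one₀ ContinuousLinearMap.norm_id_le (norm_nonneg _)
        (norm_monomial_le_one norm_universalModel_le_one _))
    rw [hfac, mul_apply_eq_comp]
    gcongr
    simpa using ContinuousLinearMap.le_of_opNorm_le _ hle (opTensor (A α) 1 f)

/-- The series converges unconditionally in norm on the regular polyball, because the squares
`X_α X_α^*` are summable in norm and the column `[A_α]` is bounded. -/
theorem summable_opTensor_monomial {E : Type w} [NormedAddCommGroup E] [InnerProductSpace ℂ E]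
    [CompleteSpace E] {X : OpTuple n E} (hX : X ∈ regularPolyball n E) {M : ℝ} (hM : 0 ≤ M)
    (hcol : ∀ (s : Finset Λ) x, ∑ α ∈ s, ‖A α x‖ ^ 2 ≤ M ^ 2 * ‖x‖ ^ 2) :
    Summable fun α : Λ => opTensor (A α) (monomial X α) := by
  have hsum := (summable_monomial_mul_adjoint hX).subtype Λ
  rw [summable_iff_vanishing_norm] at hsum
  refine summable_of_vanishing_opNorm fun ε hε => ?_
  obtain ⟨s, hs⟩ := hsum ((ε / (M + 1)) ^ 2) (by positivity)
  refine ⟨s, fun t ht => ?_⟩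
  have h1 := norm_sum_opTensor_le t (fun α : Λ => A α) (fun α : Λ => monomial X α) hM (hcol t)
  have h2 : √‖∑ α ∈ t, monomial X α * ContinuousLinearMap.adjoint (monomial X α)‖ ≤
      ε / (M + 1) := Real.sqrt_le_iff.2 ⟨by positivity, (hs t ht).le⟩
  refine h1.trans_lt ?_
  calc _ ≤ ε / (M + 1) * M := by gcongr
    _ < ε := by
      rw [div_mul_eq_mul_div, div_lt_iff₀ (by positivity)]
      linarith

/-- For orthogonal `Λ` the row `[X_α]` is a contraction, so the series is bounded by its column. -/
theorem norm_tsum_opTensor_monomial_le {E : Type w} [NormedAddCommGroup E] [InnerProductSpace ℂ E]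
    [CompleteSpace E] {X : OpTuple n E} (hX : X ∈ regularPolyball n E) (hΛ : IsOrthogonalSet Λ)
    {M : ℝ} (hM : 0 ≤ M)
    (hcol : ∀ (s : Finset Λ) x, ∑ α ∈ s, ‖A α x‖ ^ 2 ≤ M ^ 2 * ‖x‖ ^ 2) :
    ‖∑' α : Λ, opTensor (A α) (monomial X α)‖ ≤ M := by
  refine opNorm_tsum_le (summable_opTensor_monomial hX hM hcol) fun s => ?_
  refine (norm_sum_opTensor_le s (fun α : Λ => A α) (fun α : Λ => monomial X α) hM
    (hcol s)).trans (mul_le_of_le_one_left hM ?_)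
  exact Real.sqrt_le_one.2 (norm_sum_monomial_mul_adjoint_le_one hX hΛ s)

/-- If the norms of the series at the points `r S`, `0 ≤ r < 1`, are bounded by `b`, then so is the
column of the coefficients. -/
theorem sum_norm_sq_coeff_le_of_modelPoint {H : Type u} [NormedAddCommGroup H]
    [InnerProductSpace ℂ H] [CompleteSpace H] (V : Fock n →ₗᵢ[ℂ] H) {M b : ℝ} (hM : 0 ≤ M)
    (hcol : ∀ (s : Finset Λ) x, ∑ α ∈ s, ‖A α x‖ ^ 2 ≤ M ^ 2 * ‖x‖ ^ 2)
    (hb : ∀ X ∈ regularPolyball n H, ‖∑' α : Λ, opTensor (A α) (monomial X α)‖ ≤ b)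
    (s : Finset Λ) (x : K) : ∑ α ∈ s, ‖A α x‖ ^ 2 ≤ b ^ 2 * ‖x‖ ^ 2 := by
  have he : Orthonormal ℂ fun α => V (fockBasis (n := n) α) :=
    orthonormal_fockBasis.comp_linearIsometry V
  have hc : Continuous fun r : ℝ =>
      ∑ α ∈ s, (r ^ totalLength (α : Word n)) ^ 2 * ‖A α x‖ ^ 2 := by fun_prop
  have hlim := (hc.tendsto 1).mono_left (nhdsWithin_le_nhds (s := Set.Iio 1))
  simp only [one_pow, one_mul] at hlim
  refine le_of_tendsto hlim ?_
  filter_upwards [Ioo_mem_nhdsLT (zero_lt_one' ℝ)] with r hr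
  have hmem := modelPoint_mem V hr.1.le hr.2
  have hs := (summable_opTensor_monomial hmem hM hcol).hasSum
  refine (sum_norm_sq_coeff_le_of_hasStrongSum he (modelPoint_apply V r)
    (fun f => hs.mapL (ContinuousLinearMap.apply ℂ _ f)) s x).trans ?_
  gcongr
  exact hb _ hmem

end Orthogonal

end

end Polyball

theorem mainTheorem5 {k : ℕ} (hk : 1 ≤ k) (n : Fin k → ℕ) (hn : ∀ i, 1 ≤ n i)
    (H : Type u) [NormedAddCommGroup H] [InnerProductSpace ℂ H] [CompleteSpace H]
    (hH : ¬ FiniteDimensional ℂ H)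
    (K : Type v) [NormedAddCommGroup K] [InnerProductSpace ℂ K] [CompleteSpace K]
    (A : Polyball.Word n → (K →L[ℂ] K))
    (hF : Polyball.IsFreeHolomorphic.{u} A)
    (hF0 : 0 ≤ Polyball.freeEval A (0 : Polyball.OpTuple n H))
    (hRe : ∀ X ∈ Polyball.regularPolyball n H,
      (realPart (Polyball.freeEval A X) :
        Polyball.HilbertTensor K H →L[ℂ] Polyball.HilbertTensor K H) ≤ 1)
    (Λ : Set (Polyball.Word n)) (hΛ : Polyball.IsRightMinimal Λ) (hΛ1 : (1 : Polyball.Word n) ∉ Λ) :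
    (∃ P : lp (fun _ : Option Λ => K) 2 →L[ℂ] lp (fun _ : Option Λ => K) 2,
      Polyball.HasOperatorMatrix P (Polyball.landauMatrix A Λ) ∧ 0 ≤ P) ∧
    (∃ B : K →L[ℂ] K,
      Polyball.HasStrongSum (fun α : Λ => ContinuousLinearMap.adjoint (A α) * A α) B ∧
      B ≤ (4 * ‖1 - A 1‖) • (1 - A 1)) ∧
    (Polyball.IsOrthogonalSet Λ →
      ∃ T : Polyball.HilbertTensor K (Polyball.Fock n) →L[ℂ]
          Polyball.HilbertTensor K (Polyball.Fock n),
        Polyball.HasStrongSum (fun α : Λ =>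
          Polyball.opTensor (A α) (Polyball.monomial (Polyball.universalModel n) α)) T ∧
        (∀ (E : Type w) [NormedAddCommGroup E] [InnerProductSpace ℂ E] [CompleteSpace E],
          ∀ X ∈ Polyball.regularPolyball n E,
            Summable (fun α : Λ => Polyball.opTensor (A α) (Polyball.monomial X α)) ∧
            ‖∑' α : Λ, Polyball.opTensor (A α) (Polyball.monomial X α)‖ ≤ ‖T‖) ∧
        IsLUB ((fun X : Polyball.OpTuple n H =>
          ‖∑' α : Λ, Polyball.opTensor (A α) (Polyball.monomial X α)‖) ''
            Polyball.regularPolyball n H) ‖T‖ ∧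
        ‖T‖ ≤ 2 * ‖1 - A 1‖) := by
  obtain ⟨V⟩ := Polyball.exists_isometry_fock (n := n) hH
  have hA1 := Polyball.coeff_one_isPositive hF V hF0
  have hD : IsSelfAdjoint (1 - A 1) := (IsSelfAdjoint.one _).sub hA1.isSelfAdjoint
  have hpos : ∀ (s : Finset Λ) (x : K) (y : Λ → K),
      0 ≤ RCLike.re (inner ℂ x ((1 - A 1) x)) +
        ∑ α ∈ s, RCLike.re (inner ℂ (y α) ((1 - A 1) (y α)))
        - ∑ α ∈ s, RCLike.re (inner ℂ (y α) (A α x)) := by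
    classical
    intro s x y
    have h := Polyball.landau_finite hF V hRe hΛ hΛ1 (s.map (Function.Embedding.subtype _))
      (fun α hα => by
        obtain ⟨β, -, rfl⟩ := Finset.mem_map.1 hα
        exact β.2) x (fun α => if h : α ∈ Λ then y ⟨α, h⟩ else 0)
    simpa [Finset.sum_map] using h
  have hquad : ∀ (s : Finset Λ) x,
      ∑ α ∈ s, ‖A α x‖ ^ 2 ≤ 4 * ‖1 - A 1‖ * RCLike.re (inner ℂ x ((1 - A 1) x)) :=
    fun s x => Polyball.sum_norm_sq_coeff_le (A := fun α : Λ => A α) s (hpos s) x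
  have hcol : ∀ (s : Finset Λ) x, ∑ α ∈ s, ‖A α x‖ ^ 2 ≤ (2 * ‖1 - A 1‖) ^ 2 * ‖x‖ ^ 2 := by
    intro s x
    refine (hquad s x).trans ?_
    calc _ ≤ 4 * ‖1 - A 1‖ * (‖1 - A 1‖ * ‖x‖ ^ 2) := by
          gcongr
          exact Polyball.re_inner_apply_le _ _
      _ = _ := by ring
  have hM : 0 ≤ 2 * ‖1 - A 1‖ := by positivity
  refine ⟨Polyball.exists_landauMatrix_nonneg hD hM hcol hpos, ?_, fun horth => ?_⟩
  · obtain ⟨B, hB, hBsa⟩ := Polyball.exists_hasStrongSum_adjoint_mul (fun α : Λ => A α) hM hcol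
    refine ⟨B, hB, ?_⟩
    rw [ContinuousLinearMap.le_def, ContinuousLinearMap.isPositive_def']
    refine ⟨(IsSelfAdjoint.smul (IsSelfAdjoint.all _) hD).sub hBsa, fun x => ?_⟩
    rw [ContinuousLinearMap.reApplyInnerSelf_apply, inner_re_symm, sub_apply, inner_sub_right,
      map_sub, sub_nonneg, smul_apply, ← Complex.coe_smul, inner_smul_right]
    have h1 : RCLike.re (((4 * ‖1 - A 1‖ : ℝ) : ℂ) * inner ℂ x ((1 - A 1) x)) =
        4 * ‖1 - A 1‖ * RCLike.re (inner ℂ x ((1 - A 1) x)) := Complex.re_ofReal_mul _ _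
    rw [h1]
    have h2 := RCLike.hasSum_re ℂ ((hB x).mapL (innerSL ℂ x))
    refine le_of_tendsto h2 (Filter.Eventually.of_forall fun s => ?_)
    refine le_trans (le_of_eq (Finset.sum_congr rfl fun α _ => ?_)) (hquad s x)
    simp only [innerSL_apply_apply]
    rw [mul_apply_eq_comp, ContinuousLinearMap.adjoint_inner_right,
      inner_self_eq_norm_sq]
  · obtain ⟨T, hT, hTM⟩ := Polyball.exists_hasStrongSum_universalModel horth hM hcol
    -- the column of the coefficients is bounded by the norm of `T` itself
    have hcolT : ∀ (s : Finset Λ) x, ∑ α ∈ s, ‖A α x‖ ^ 2 ≤ ‖T‖ ^ 2 * ‖x‖ ^ 2 := by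
      intro s x
      simpa using Polyball.sum_norm_sq_coeff_le_of_hasStrongSum (r := 1)
        Polyball.orthonormal_fockBasis
        (fun i j α => by rw [Polyball.universalModel_fockBasis, Complex.ofReal_one, one_smul])
        hT s x
    refine ⟨T, hT, fun E _ _ _ X hX =>
      ⟨Polyball.summable_opTensor_monomial hX hM hcol,
        Polyball.norm_tsum_opTensor_monomial_le hX horth (norm_nonneg T) hcolT⟩, ⟨?_, ?_⟩, hTM⟩
    · rintro _ ⟨X, hX, rfl⟩
      exact Polyball.norm_tsum_opTensor_monomial_le hX horth (norm_nonneg T) hcolT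
    · intro b hb
      have hb' : ∀ X ∈ Polyball.regularPolyball n H,
          ‖∑' α : Λ, Polyball.opTensor (A α) (Polyball.monomial X α)‖ ≤ b :=
        fun X hX => hb ⟨X, hX, rfl⟩
      have hb0 : 0 ≤ b :=
        (ContinuousLinearMap.opNorm_nonneg _).trans
          (hb' _ (Polyball.modelPoint_mem V le_rfl one_pos))
      -- a bound for the column is a bound for the norm of the strong sum, which is unique
      obtain ⟨T', hT', hTb⟩ := Polyball.exists_hasStrongSum_universalModel horth hb0
        (Polyball.sum_norm_sq_coeff_le_of_modelPoint V hM hcol hb')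
      have : T = T' := ContinuousLinearMap.ext fun f => (hT f).unique (hT' f)
      rw [this]
      exact hTb
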